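/- Let $a>0$, $b<0$, $T>0$, $\Gamma=(-\tfrac12,\tfrac12)^2$, $D=\Gamma\times(b,a)\subset\mathbb{R}^3$ and $Q_T=D\times(0,T)$, with points $(\mathbf{x},\tau)=(x,y,z,\tau)$. Put $\Gamma_m=\Gamma\times\{a\}$, $\Gamma_b=\Gamma\times\{b\}$ and $\Gamma_3=\partial D\setminus(\Gamma_m\cup\Gamma_b)$, and let $\partial_\nu$ be the outward normal derivative on $\partial D$. All boundary and initial values below are traces. For every $C>0$ there is a constant $C_1=C_1(C,Q_T)>0$ with the following property. Let $\widetilde g=\widetilde g(x,y,t)\in H^2(\Gamma_m\times(0,T))$ be real-valued, and suppose that there is a solution $u\in H^2(Q_T)$ of $$u_{\tau\tau}=\Delta u \ \text{ in } Q_T,\qquad u(\mathbf{x},0)=u_\tau(\mathbf{x},0)=0 \ \text{ in } D,$$ $$u|_{\Gamma_m\times(0,T)}=\widetilde g(x,y,T-\tau),\qquad (\partial_\nu u+u_\tau)|_{\Gamma_b\times(0,T)}=0,\qquad \partial_\nu u|_{\Gamma_3\times(0,T)}=0.$$ Suppose also that there is a function $F\in H^2(Q_T)$ with $$F(\mathbf{x},0)=F_\tau(\mathbf{x},0)=0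 \ \text{ in } D,\qquad (\partial_\nu F+F_\tau)|_{\Gamma_b\times(0,T)}=0,\qquad \partial_\nu F|_{\Gamma_3\times(0,T)}=0,$$ $$F|_{\Gamma_m\times(0,T)}=\widetilde g(x,y,T-\tau),\qquad \|F\|_{H^2(Q_T)}\le C\,\|\widetilde g\|_{H^2(\Gamma_m\times(0,T))}.$$ Then $u$ is the only solution of this problem in $H^2(Q_T)$, and $$\|u\|_{H^1(Q_T)}\le C_1\,\|\widetilde g\|_{H^2(\Gamma_m\times(0,T))}.$$ -/

import Mathlib

open MeasureTheory Filter Topology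
open scoped ContDiff

noncomputable section

namespace TimeReversal

/-- The open box with corners `lo` and `hi` in `ℝⁿ`. -/
def box {n : ℕ} (lo hi : Fin n → ℝ) : Set (Fin n → ℝ) :=
  {p | ∀ i, lo i < p i ∧ p i < hi i}

/-! ### Sobolev spaces on open subsets of `ℝⁿ` -/

/-- `v` is the weak partial derivative `∂u/∂xᵢ` on `Ω`. -/
def HasWeakDeriv {n : ℕ} (Ω : Set (Fin n → ℝ)) (i : Fin n) (u v : (Fin n → ℝ) → ℝ) : Prop :=
  LocallyIntegrableOn u Ω volume ∧ LocallyIntegrableOn v Ω volume ∧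
    ∀ φ : (Fin n → ℝ) → ℝ, ContDiff ℝ ∞ φ → HasCompactSupport φ → tsupport φ ⊆ Ω →
      ∫ p in Ω, u p * fderiv ℝ φ p (Pi.single i 1) = -∫ p in Ω, v p * φ p

/-- The weak partial derivative `∂u/∂xᵢ` on `Ω`, determined up to a null set of `Ω` where it
exists. -/
def weakDeriv {n : ℕ} (Ω : Set (Fin n → ℝ)) (i : Fin n) (u : (Fin n → ℝ) → ℝ) :
    (Fin n → ℝ) → ℝ :=
  Classical.epsilon (HasWeakDeriv Ω i u)

/-- `u ∈ Hᵏ(Ω)`: all weak partial derivatives of `u` of order at most `k` exist and lie in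
`L²(Ω)`. -/
def MemH {n : ℕ} (Ω : Set (Fin n → ℝ)) : ℕ → ((Fin n → ℝ) → ℝ) → Prop
  | 0, u => MemLp u 2 (volume.restrict Ω)
  | k + 1, u => MemLp u 2 (volume.restrict Ω) ∧
      ∀ i, ∃ v, HasWeakDeriv Ω i u v ∧ MemH Ω k v

/-- The squared norm of `L²(Ω)`. -/
def l2NormSq {n : ℕ} (Ω : Set (Fin n → ℝ)) (u : (Fin n → ℝ) → ℝ) : ℝ :=
  ∫ p in Ω, u p ^ 2

/-- The norm of `H¹(Ω)`. -/
def h1Norm {n : ℕ} (Ω : Set (Fin n → ℝ)) (u : (Fin n → ℝ) → ℝ) : ℝ :=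
  Real.sqrt (l2NormSq Ω u + ∑ i, l2NormSq Ω (weakDeriv Ω i u))

/-- The norm of `H²(Ω)`; the second-order multi-indices correspond to the pairs `i ≤ j`. -/
def h2Norm {n : ℕ} (Ω : Set (Fin n → ℝ)) (u : (Fin n → ℝ) → ℝ) : ℝ :=
  Real.sqrt (l2NormSq Ω u + ∑ i, l2NormSq Ω (weakDeriv Ω i u) +
    ∑ i, ∑ j ∈ Finset.Ici i, l2NormSq Ω (weakDeriv Ω j (weakDeriv Ω i u)))

/-! ### Traces on the faces of a box -/

/-- `h ∈ L²` is the trace of `v ∈ H¹(box lo hi)` on the face `xᵢ = c` of the box, where `c` is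
`lo i` or `hi i`. The face is parametrized by the remaining coordinates. The trace operator is
the extension by continuity of the restriction to the face from functions smooth up to the
boundary to all of `H¹`. -/
def IsTrace {n : ℕ} (lo hi : Fin (n + 1) → ℝ) (i : Fin (n + 1)) (c : ℝ)
    (v : (Fin (n + 1) → ℝ) → ℝ) (h : (Fin n → ℝ) → ℝ) : Prop :=
  MemH (box lo hi) 1 v ∧
  MemLp h 2 (volume.restrict (box (i.removeNth lo) (i.removeNth hi))) ∧
  ∃ φ : ℕ → (Fin (n + 1) → ℝ) → ℝ, (∀ k, ContDiff ℝ ∞ (φ k)) ∧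
    Tendsto (fun k => h1Norm (box lo hi) (fun p => φ k p - v p)) atTop (𝓝 0) ∧
    Tendsto (fun k => l2NormSq (box (i.removeNth lo) (i.removeNth hi))
      (fun y => φ k (i.insertNth c y) - h y)) atTop (𝓝 0)

/-! ### The time-reversed data-propagation problem

Points of space-time are `(x, y, z, τ)`, with indices `0, 1, 2, 3`. -/

/-- Lower corner of `Q_T`. -/
def qLo (b : ℝ) : Fin 4 → ℝ := ![-1 / 2, -1 / 2, b, 0]

/-- Upper corner of `Q_T`. -/
def qHi (a T : ℝ) : Fin 4 → ℝ := ![1 / 2, 1 / 2, a, T]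

/-- `Q_T = D × (0, T)` with `D = (-1/2, 1/2) × (-1/2, 1/2) × (b, a)`. -/
def QT (a b T : ℝ) : Set (Fin 4 → ℝ) := box (qLo b) (qHi a T)

/-- `Γ_m × (0, T)`, in the coordinates `(x, y, t)` of the face `z = a`. -/
def GammaM (T : ℝ) : Set (Fin 3 → ℝ) := box ![-1 / 2, -1 / 2, 0] ![1 / 2, 1 / 2, T]

/-- The homogeneous conditions of the problem on `u ∈ H²(Q_T)`. -/
structure HomogeneousConditions (a b T : ℝ) (u : (Fin 4 → ℝ) → ℝ) : Prop where
  /-- `u = 0` at `τ = 0` -/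
  initial : IsTrace (qLo b) (qHi a T) 3 0 u 0
  /-- `u_τ = 0` at `τ = 0` -/
  initial_deriv : IsTrace (qLo b) (qHi a T) 3 0 (weakDeriv (QT a b T) 3 u) 0
  /-- `∂_ν u + u_τ = 0` on `Γ_b × (0, T)`, where `∂_ν = -∂_z` -/
  absorbing : IsTrace (qLo b) (qHi a T) 2 b
    (fun p => -weakDeriv (QT a b T) 2 u p + weakDeriv (QT a b T) 3 u p) 0
  /-- `∂_ν u = 0` on the face `x = -1/2` -/
  neumann_x_lo : IsTrace (qLo b) (qHi a T) 0 (-1 / 2) (fun p => -weakDeriv (QT a b T) 0 u p) 0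
  /-- `∂_ν u = 0` on the face `x = 1/2` -/
  neumann_x_hi : IsTrace (qLo b) (qHi a T) 0 (1 / 2) (weakDeriv (QT a b T) 0 u) 0
  /-- `∂_ν u = 0` on the face `y = -1/2` -/
  neumann_y_lo : IsTrace (qLo b) (qHi a T) 1 (-1 / 2) (fun p => -weakDeriv (QT a b T) 1 u p) 0
  /-- `∂_ν u = 0` on the face `y = 1/2` -/
  neumann_y_hi : IsTrace (qLo b) (qHi a T) 1 (1 / 2) (weakDeriv (QT a b T) 1 u) 0

/-- The Dirichlet condition `u(x, y, a, τ) = g(x, y, T - τ)` on `Γ_m × (0, T)`. -/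
def DirichletData (a b T : ℝ) (g : (Fin 3 → ℝ) → ℝ) (u : (Fin 4 → ℝ) → ℝ) : Prop :=
  IsTrace (qLo b) (qHi a T) 2 a u (fun y => g ![y 0, y 1, T - y 2])

/-- `u ∈ H²(Q_T)` solves the time-reversed data-propagation problem with data `g`. -/
structure IsSolution (a b T : ℝ) (g : (Fin 3 → ℝ) → ℝ) (u : (Fin 4 → ℝ) → ℝ) : Prop where
  memH : MemH (QT a b T) 2 u
  /-- `u_ττ = u_xx + u_yy + u_zz` in `Q_T` -/
  wave : ∀ᵐ p ∂volume.restrict (QT a b T),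
    weakDeriv (QT a b T) 3 (weakDeriv (QT a b T) 3 u) p =
      weakDeriv (QT a b T) 0 (weakDeriv (QT a b T) 0 u) p +
      weakDeriv (QT a b T) 1 (weakDeriv (QT a b T) 1 u) p +
      weakDeriv (QT a b T) 2 (weakDeriv (QT a b T) 2 u) p
  homogeneous : HomogeneousConditions a b T u
  dirichlet : DirichletData a b T g u

/-- `F ∈ H²(Q_T)` is a lifting of the Dirichlet data that satisfies the homogeneous conditions,
with `‖F‖_{H²(Q_T)} ≤ C ‖g‖_{H²(Γ_m × (0, T))}`. -/
structure IsLifting (a b T C : ℝ) (g : (Fin 3 → ℝ) → ℝ) (F : (Fin 4 → ℝ) → ℝ) : Prop where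
  memH : MemH (QT a b T) 2 F
  homogeneous : HomogeneousConditions a b T F
  dirichlet : DirichletData a b T g F
  bound : h2Norm (QT a b T) F ≤ C * h2Norm (GammaM T) g

end TimeReversal

end

/-! The proof is an energy estimate for `w = u - F`, which has zero initial and boundary data and
solves `w_ττ - Δw = f` with `f = ΔF - F_ττ`. Multiply by `θ w_τ` with `θ = T - τ` and integrate over
`Q_T`. The weight vanishes at `τ = T`, so nothing is needed at the final time, and its derivative
`-1` turns `2 ∫ θ v v_τ` into `∫ v²` for each first derivative `v` of `w`, since `v` vanishes at `τ
= 0`. This replaces Gronwall's inequality. In space, the Neumann faces contribute nothing, the face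
`z = a` contributes nothing because `w_τ = 0` there, and on `z = b` the absorbing condition `w_z =
w_τ` gives a boundary term of favourable sign. Hence half of `∫ |∇w|²`, with `∇` the space-time
gradient, is at most `∫ θ f w_τ`, and Young's inequality bounds `∇w` by `f`. The same weight bounds
`w` by `w_τ`. As `f` is controlled by the `H²` norm of `F`, the bound on `u` follows; with `f = 0`
the estimate for the difference of two solutions gives uniqueness.

The difficulty is regularity: traces are given only by smooth approximants, with a different
sequence for each derivative and each face. Vanishing on a face is therefore recast as an integral
identity (`WeakZeroTrace`), which no longer mentions the sequence and can be paired with any other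
approximated function (`WeakZeroTrace.integral_mul`). `HasTrace.weakZeroTrace_tangential` passes
from a vanishing trace to vanishing tangential derivatives. Each first derivative of `w` occurs in
some boundary or initial condition, which supplies its approximants, so no density theorem is used.
The pieces meet in `energy_estimate`. -/

namespace TimeReversal

/-! ### Convergence in `L²` -/

/-- `F k → f` in `L²(μ)`. -/
structure L2Tendsto {α : Type*} [MeasurableSpace α] (μ : Measure α) (F : ℕ → α → ℝ)
    (f : α → ℝ) : Prop where
  memLp : ∀ k, MemLp (F k) 2 μ
  memLp_lim : MemLp f 2 μ
  tendsto : Tendsto (fun k => ∫ x, (F k x - f x) ^ 2 ∂μ) atTop (𝓝 0)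

section L2

variable {α : Type*} [MeasurableSpace α] {μ : Measure α}

theorem integrable_mul_of_memLp {f g : α → ℝ} (hf : MemLp f 2 μ) (hg : MemLp g 2 μ) :
    Integrable (fun x => f x * g x) μ :=
  hf.integrable_mul hg

theorem integrable_sq_of_memLp {f : α → ℝ} (hf : MemLp f 2 μ) :
    Integrable (fun x => f x ^ 2) μ := by
  simpa [sq] using integrable_mul_of_memLp hf hf

theorem abs_integral_mul_le_sqrt_mul_sqrt {f g : α → ℝ} (hf : MemLp f 2 μ) (hg : MemLp g 2 μ) :
    |∫ x, f x * g x ∂μ| ≤ √(∫ x, f x ^ 2 ∂μ) * √(∫ x, g x ^ 2 ∂μ) := by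
  have h := integral_mul_norm_le_Lp_mul_Lq (μ := μ) (f := f) (g := g) Real.HolderConjugate.two_two
    (by simpa using hf) (by simpa using hg)
  simp only [Real.norm_eq_abs, Real.rpow_two, sq_abs, ← Real.sqrt_eq_rpow] at h
  refine le_trans ?_ h
  simpa [abs_mul] using abs_integral_le_integral_abs (μ := μ) (f := fun x => f x * g x)

theorem memLp_mul_of_bound {m f : α → ℝ} {M : ℝ} (hm : AEStronglyMeasurable m μ)
    (hM : ∀ᵐ x ∂μ, |m x| ≤ M) (hf : MemLp f 2 μ) : MemLp (fun x => m x * f x) 2 μ :=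
  MemLp.of_le_mul (c := M) hf (hm.mul hf.1) (by
    filter_upwards [hM] with x hx
    rw [norm_mul]
    exact mul_le_mul_of_nonneg_right hx (norm_nonneg _))

theorem integral_add_sq_le {f g : α → ℝ} (hf : MemLp f 2 μ) (hg : MemLp g 2 μ) :
    ∫ x, (f x + g x) ^ 2 ∂μ ≤ 2 * ∫ x, f x ^ 2 ∂μ + 2 * ∫ x, g x ^ 2 ∂μ := by
  have h1 := (integrable_sq_of_memLp hf).const_mul 2
  have h2 := (integrable_sq_of_memLp hg).const_mul 2
  rw [← integral_const_mul, ← integral_const_mul, ← integral_add h1 h2]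
  refine integral_mono (integrable_sq_of_memLp (hf.add hg)) (h1.add h2) fun x => ?_
  nlinarith [sq_nonneg (f x - g x)]

theorem integral_sub_sq_le {f g : α → ℝ} (hf : MemLp f 2 μ) (hg : MemLp g 2 μ) :
    ∫ x, (f x - g x) ^ 2 ∂μ ≤ 2 * ∫ x, f x ^ 2 ∂μ + 2 * ∫ x, g x ^ 2 ∂μ := by
  simpa [sub_eq_add_neg] using integral_add_sq_le hf hg.neg

namespace L2Tendsto

variable {F G : ℕ → α → ℝ} {f g : α → ℝ}

/-- Split `F k * G k - f * g` into the product of the two errors and two cross terms, and apply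
Cauchy–Schwarz to each. Every bilinear identity for smooth functions reaches its `L²` limit this
way. -/
theorem integral_mul (hF : L2Tendsto μ F f) (hG : L2Tendsto μ G g) :
    Tendsto (fun k => ∫ x, F k x * G k x ∂μ) atTop (𝓝 (∫ x, f x * g x ∂μ)) := by
  have sF : Tendsto (fun k => √(∫ x, (F k x - f x) ^ 2 ∂μ)) atTop (𝓝 0) := by
    simpa using hF.tendsto.sqrt
  have sG : Tendsto (fun k => √(∫ x, (G k x - g x) ^ 2 ∂μ)) atTop (𝓝 0) := by
    simpa using hG.tendsto.sqrt
  have key : Tendsto (fun k => ∫ x, F k x * G k x ∂μ - ∫ x, f x * g x ∂μ) atTop (𝓝 0) := by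
    have hb := ((sF.mul sG).add (sF.mul_const (√(∫ x, g x ^ 2 ∂μ)))).add
      (sG.const_mul (√(∫ x, f x ^ 2 ∂μ)))
    simp only [zero_mul, mul_zero, add_zero] at hb
    refine squeeze_zero_norm (fun k => ?_) hb
    have dF := (hF.memLp k).sub hF.memLp_lim
    have dG := (hG.memLp k).sub hG.memLp_lim
    have i1 := integrable_mul_of_memLp dF dG
    have i2 := integrable_mul_of_memLp dF hG.memLp_lim
    have i3 := integrable_mul_of_memLp hF.memLp_lim dG
    have i12 : Integrable (fun x => (F k - f) x * (G k - g) x + (F k - f) x * g x) μ := i1.add i2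
    have e : ∫ x, F k x * G k x ∂μ - ∫ x, f x * g x ∂μ =
        ∫ x, (F k - f) x * (G k - g) x ∂μ + ∫ x, (F k - f) x * g x ∂μ
          + ∫ x, f x * (G k - g) x ∂μ := by
      rw [← integral_sub (integrable_mul_of_memLp (hF.memLp k) (hG.memLp k))
        (integrable_mul_of_memLp hF.memLp_lim hG.memLp_lim), ← integral_add i1 i2,
        ← integral_add i12 i3]
      refine integral_congr_ae (ae_of_all _ fun x => ?_)
      simp only [Pi.sub_apply]
      ring
    rw [e, Real.norm_eq_abs]
    refine (abs_add_three _ _ _).trans ?_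
    gcongr
    · exact abs_integral_mul_le_sqrt_mul_sqrt dF dG
    · exact abs_integral_mul_le_sqrt_mul_sqrt dF hG.memLp_lim
    · exact abs_integral_mul_le_sqrt_mul_sqrt hF.memLp_lim dG
  simpa using key.add_const (∫ x, f x * g x ∂μ)

theorem const (hf : MemLp f 2 μ) : L2Tendsto μ (fun _ => f) f where
  memLp _ := hf
  memLp_lim := hf
  tendsto := by simp

theorem sub (hF : L2Tendsto μ F f) (hG : L2Tendsto μ G g) :
    L2Tendsto μ (fun k x => F k x - G k x) (fun x => f x - g x) where
  memLp k := (hF.memLp k).sub (hG.memLp k)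
  memLp_lim := hF.memLp_lim.sub hG.memLp_lim
  tendsto := by
    have hb := (hF.tendsto.const_mul 2).add (hG.tendsto.const_mul 2)
    simp only [mul_zero, add_zero] at hb
    refine squeeze_zero (fun k => integral_nonneg fun x => sq_nonneg _) (fun k => ?_) hb
    have h := integral_sub_sq_le ((hF.memLp k).sub hF.memLp_lim) ((hG.memLp k).sub hG.memLp_lim)
    simp only [Pi.sub_apply] at h
    refine le_trans (le_of_eq ?_) h
    refine integral_congr_ae (ae_of_all _ fun x => ?_)
    simp only
    ring

theorem bdd_mul {m : α → ℝ} {M : ℝ} (hm : AEStronglyMeasurable m μ)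
    (hM : ∀ᵐ x ∂μ, |m x| ≤ M) (hF : L2Tendsto μ F f) :
    L2Tendsto μ (fun k x => m x * F k x) (fun x => m x * f x) where
  memLp k := memLp_mul_of_bound hm hM (hF.memLp k)
  memLp_lim := memLp_mul_of_bound hm hM hF.memLp_lim
  tendsto := by
    have hb := hF.tendsto.const_mul (M ^ 2)
    simp only [mul_zero] at hb
    refine squeeze_zero (fun k => integral_nonneg fun x => sq_nonneg _) (fun k => ?_) hb
    have d := (hF.memLp k).sub hF.memLp_lim
    rw [← integral_const_mul]
    refine integral_mono_ae ?_ ((integrable_sq_of_memLp d).const_mul _) ?_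
    · refine (integrable_sq_of_memLp (memLp_mul_of_bound hm hM d)).congr (ae_of_all _ fun x => ?_)
      simp only [Pi.sub_apply]
      ring
    · filter_upwards [hM] with x hx
      have h := sq_le_sq' (abs_le.1 hx).1 (abs_le.1 hx).2
      calc (m x * F k x - m x * f x) ^ 2 = m x ^ 2 * (F k x - f x) ^ 2 := by ring
        _ ≤ M ^ 2 * (F k x - f x) ^ 2 := mul_le_mul_of_nonneg_right h (sq_nonneg _)

theorem congr_lim (hF : L2Tendsto μ F f) (h : f =ᵐ[μ] g) : L2Tendsto μ F g where
  memLp := hF.memLp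
  memLp_lim := (memLp_congr_ae h).1 hF.memLp_lim
  tendsto := by
    refine hF.tendsto.congr fun k => integral_congr_ae ?_
    filter_upwards [h] with x hx
    rw [hx]

end L2Tendsto

end L2

/-! ### Boxes -/

section Box

variable {n : ℕ} {lo hi : Fin n → ℝ}

theorem box_eq_pi : box lo hi = Set.pi Set.univ fun i => Set.Ioo (lo i) (hi i) := by
  ext p
  simp [box, Set.mem_pi]

theorem isOpen_box : IsOpen (box lo hi) := by
  rw [box_eq_pi]
  exact isOpen_set_pi Set.finite_univ fun i _ => isOpen_Ioo

theorem box_ae_eq_Icc : box lo hi =ᵐ[volume] Set.Icc lo hi := by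
  rw [box_eq_pi]
  exact Measure.univ_pi_Ioo_ae_eq_Icc

theorem box_subset_Icc : box lo hi ⊆ Set.Icc lo hi := fun _ hp =>
  ⟨fun i => (hp i).1.le, fun i => (hp i).2.le⟩

instance isFiniteMeasure_restrict_box : IsFiniteMeasure (volume.restrict (box lo hi)) :=
  ⟨by
    rw [Measure.restrict_apply_univ]
    exact (measure_mono box_subset_Icc).trans_lt isCompact_Icc.measure_lt_top⟩

theorem exists_bound_on_box {m : (Fin n → ℝ) → ℝ} (hm : Continuous m) :
    ∃ M, ∀ᵐ p ∂volume.restrict (box lo hi), |m p| ≤ M := by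
  obtain ⟨M, hM⟩ := (isCompact_Icc (a := lo) (b := hi)).exists_bound_of_continuousOn
    hm.continuousOn
  exact ⟨M, (ae_restrict_iff' isOpen_box.measurableSet).2
    (ae_of_all _ fun p hp => hM p (box_subset_Icc hp))⟩

theorem memLp_of_continuous {m : (Fin n → ℝ) → ℝ} (hm : Continuous m) :
    MemLp m 2 (volume.restrict (box lo hi)) := by
  obtain ⟨M, hM⟩ := exists_bound_on_box (lo := lo) (hi := hi) hm
  exact MemLp.of_bound hm.aestronglyMeasurable M hM

theorem memLp_continuous_mul {m f : (Fin n → ℝ) → ℝ} (hm : Continuous m)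
    (hf : MemLp f 2 (volume.restrict (box lo hi))) :
    MemLp (fun p => m p * f p) 2 (volume.restrict (box lo hi)) := by
  obtain ⟨M, hM⟩ := exists_bound_on_box (lo := lo) (hi := hi) hm
  exact memLp_mul_of_bound hm.aestronglyMeasurable hM hf

theorem L2Tendsto.continuous_mul {m f : (Fin n → ℝ) → ℝ} {F : ℕ → (Fin n → ℝ) → ℝ}
    (hm : Continuous m) (hF : L2Tendsto (volume.restrict (box lo hi)) F f) :
    L2Tendsto (volume.restrict (box lo hi)) (fun k p => m p * F k p) (fun p => m p * f p) := by
  obtain ⟨M, hM⟩ := exists_bound_on_box (lo := lo) (hi := hi) hm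
  exact hF.bdd_mul hm.aestronglyMeasurable hM

theorem integrable_continuous_mul_mul {m f g : (Fin n → ℝ) → ℝ} (hm : Continuous m)
    (hf : MemLp f 2 (volume.restrict (box lo hi))) (hg : MemLp g 2 (volume.restrict (box lo hi))) :
    Integrable (fun p => m p * f p * g p) (volume.restrict (box lo hi)) :=
  integrable_mul_of_memLp (memLp_continuous_mul hm hf) hg

end Box

/-! ### Classical partial derivatives -/

/-- The classical partial derivative `∂φ/∂xᵢ`. -/
noncomputable def pd {n : ℕ} (i : Fin n) (φ : (Fin n → ℝ) → ℝ) : (Fin n → ℝ) → ℝ :=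
  fun p => fderiv ℝ φ p (Pi.single i 1)

section Partial

variable {n : ℕ} {φ ψ : (Fin n → ℝ) → ℝ}

theorem contDiff_pd (i : Fin n) (hφ : ContDiff ℝ ∞ φ) : ContDiff ℝ ∞ (pd i φ) :=
  (hφ.fderiv_right (m := ∞) (by simp)).clm_apply contDiff_const

theorem pd_mul (i : Fin n) (hφ : ContDiff ℝ ∞ φ) (hψ : ContDiff ℝ ∞ ψ) (p : Fin n → ℝ) :
    pd i (fun p => φ p * ψ p) p = pd i φ p * ψ p + φ p * pd i ψ p := by
  have h1 := (hφ.differentiable (by simp)) p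
  have h2 := (hψ.differentiable (by simp)) p
  unfold pd
  rw [fderiv_fun_mul h1 h2]
  simp
  ring

theorem pd_sub (i : Fin n) (hφ : ContDiff ℝ ∞ φ) (hψ : ContDiff ℝ ∞ ψ) :
    pd i (fun p => φ p - ψ p) = fun p => pd i φ p - pd i ψ p := by
  funext p
  have h1 := (hφ.differentiable (by simp)) p
  have h2 := (hψ.differentiable (by simp)) p
  unfold pd
  rw [fderiv_fun_sub h1 h2]
  simp

theorem pd_comm (i j : Fin n) (hφ : ContDiff ℝ ∞ φ) : pd i (pd j φ) = pd j (pd i φ) := by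
  funext p
  have hd : DifferentiableAt ℝ (fderiv ℝ φ) p :=
    (hφ.fderiv_right (m := ∞) (by simp)).differentiable (by simp) p
  have hs : IsSymmSndFDerivAt ℝ φ p := hφ.contDiffAt.isSymmSndFDerivAt (by
    rw [minSmoothness_of_isRCLikeNormedField]; exact WithTop.coe_le_coe.2 le_top)
  have e : ∀ i j : Fin n, pd i (pd j φ) p =
      fderiv ℝ (fderiv ℝ φ) p (Pi.single i 1) (Pi.single j 1) := by
    intro i j
    unfold pd
    rw [fderiv_clm_apply hd (differentiableAt_const _)]
    simp
  rw [e, e]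
  exact hs _ _

theorem pd_eq_zero_of_line {i : Fin n} (hφ : ContDiff ℝ ∞ φ) {p : Fin n → ℝ}
    (h : ∀ t : ℝ, φ (p + t • Pi.single i 1) = φ p) : pd i φ p = 0 := by
  have hd := (hφ.differentiable (by simp)) p
  unfold pd
  rw [← hd.lineDeriv_eq_fderiv, lineDeriv]
  simp only [h]
  simp

/-- The direction `j` is tangent to the hyperplane, so `φ` is constant along the line through `p`.
-/
theorem pd_eq_zero_of_face {i j : Fin n} (hij : j ≠ i) (hφ : ContDiff ℝ ∞ φ) {c : ℝ}
    (h : ∀ p, p i = c → φ p = 0) {p : Fin n → ℝ} (hp : p i = c) : pd j φ p = 0 := by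
  refine pd_eq_zero_of_line hφ fun t => ?_
  rw [h p hp, h]
  simp [hp, hij.symm]

end Partial

/-- Integration of a partial derivative over a box. -/
theorem integral_pd {n : ℕ} {lo hi : Fin (n + 1) → ℝ} (hle : lo ≤ hi) (i : Fin (n + 1))
    {φ : (Fin (n + 1) → ℝ) → ℝ} (hφ : ContDiff ℝ ∞ φ) :
    ∫ p in box lo hi, pd i φ p =
      (∫ y in box (i.removeNth lo) (i.removeNth hi), φ (i.insertNth (hi i) y)) -
        ∫ y in box (i.removeNth lo) (i.removeNth hi), φ (i.insertNth (lo i) y) := by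
  -- The divergence theorem for the vector field whose only nonzero component is `φ`, in direction
  -- `i`.
  have h := integral_divergence_of_hasFDerivAt_off_countable' lo hi hle
    (Pi.single i φ : Fin (n + 1) → (Fin (n + 1) → ℝ) → ℝ)
    (Pi.single i (fderiv ℝ φ) : Fin (n + 1) → (Fin (n + 1) → ℝ) → _) ∅ Set.countable_empty
    (fun j => by
      rcases eq_or_ne j i with rfl | hj
      · simpa using hφ.continuous.continuousOn
      · simp only [Pi.single_eq_of_ne hj]
        exact continuousOn_const)
    (fun x _ j => by
      rcases eq_or_ne j i with rfl | hj
      · simpa using ((hφ.differentiable (by simp)) x).hasFDerivAt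
      · simp only [Pi.single_eq_of_ne hj]
        exact hasFDerivAt_const _ _)
    (by
      have : (fun x => ∑ j, (Pi.single i (fderiv ℝ φ) : Fin (n + 1) → (Fin (n + 1) → ℝ) → _) j x
          (Pi.single j 1)) = pd i φ := by
        funext x
        rw [Finset.sum_eq_single i]
        · simp [pd]
        · intro j _ hj
          simp [Pi.single_eq_of_ne hj]
        · simp
      rw [this]
      exact (contDiff_pd i hφ).continuous.continuousOn.integrableOn_compact isCompact_Icc)
  rw [setIntegral_congr_set box_ae_eq_Icc, setIntegral_congr_set box_ae_eq_Icc,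
    setIntegral_congr_set box_ae_eq_Icc]
  rw [Finset.sum_eq_single i] at h
  · simp only [Pi.single_eq_same] at h
    refine Eq.trans ?_ h
    refine integral_congr_ae (ae_of_all _ fun x => ?_)
    simp only
    rw [Finset.sum_eq_single i]
    · simp [pd]
    · intro j _ hj
      simp [Pi.single_eq_of_ne hj]
    · simp
  · intro j _ hj
    simp [Pi.single_eq_of_ne hj]
  · simp

/-! ### Functions with gradient and trace, approximated by smooth functions -/

/-- `p` with gradient `P` is the `H¹(Ω)`-limit of the smooth functions `φ k`. -/
structure ApproxBy {n : ℕ} (Ω : Set (Fin n → ℝ)) (φ : ℕ → (Fin n → ℝ) → ℝ)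
    (p : (Fin n → ℝ) → ℝ) (P : Fin n → (Fin n → ℝ) → ℝ) : Prop where
  smooth : ∀ k, ContDiff ℝ ∞ (φ k)
  tendsto : L2Tendsto (volume.restrict Ω) φ p
  tendsto_pd : ∀ i, L2Tendsto (volume.restrict Ω) (fun k => pd i (φ k)) (P i)

/-- `p` with gradient `P` is an `H¹`-limit of smooth functions on the box, and has trace `h` on
the face `xᵢ = c`. -/
def HasTrace {n : ℕ} (lo hi : Fin (n + 1) → ℝ) (i : Fin (n + 1)) (c : ℝ)
    (p : (Fin (n + 1) → ℝ) → ℝ) (P : Fin (n + 1) → (Fin (n + 1) → ℝ) → ℝ)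
    (h : (Fin n → ℝ) → ℝ) : Prop :=
  ∃ φ, ApproxBy (box lo hi) φ p P ∧
    L2Tendsto (volume.restrict (box (i.removeNth lo) (i.removeNth hi)))
      (fun k y => φ k (i.insertNth c y)) h

/-- `p` with partial derivative `p'` in direction `i` integrates by parts without boundary terms
against smooth functions that vanish on those faces `xᵢ = lo i`, `xᵢ = hi i` which differ from
`xᵢ = c`. -/
def WeakZeroTrace {n : ℕ} (lo hi : Fin n → ℝ) (i : Fin n) (c : ℝ)
    (p p' : (Fin n → ℝ) → ℝ) : Prop :=
  ∀ ψ, ContDiff ℝ ∞ ψ → (∀ x, (x i = lo i ∨ x i = hi i) → x i ≠ c → ψ x = 0) →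
    ∫ x in box lo hi, (pd i ψ x * p x + ψ x * p' x) = 0

namespace ApproxBy

variable {n : ℕ} {Ω : Set (Fin n → ℝ)} {φ ψ : ℕ → (Fin n → ℝ) → ℝ} {p q : (Fin n → ℝ) → ℝ}
  {P Q : Fin n → (Fin n → ℝ) → ℝ}

theorem memLp (h : ApproxBy Ω φ p P) : MemLp p 2 (volume.restrict Ω) := h.tendsto.memLp_lim

theorem memLp_pd (h : ApproxBy Ω φ p P) (i : Fin n) : MemLp (P i) 2 (volume.restrict Ω) :=
  (h.tendsto_pd i).memLp_lim

theorem sub (hp : ApproxBy Ω φ p P) (hq : ApproxBy Ω ψ q Q) :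
    ApproxBy Ω (fun k x => φ k x - ψ k x) (fun x => p x - q x) (fun i x => P i x - Q i x) where
  smooth k := (hp.smooth k).sub (hq.smooth k)
  tendsto := hp.tendsto.sub hq.tendsto
  tendsto_pd i := by
    simpa only [pd_sub i (hp.smooth _) (hq.smooth _)] using
      (hp.tendsto_pd i).sub (hq.tendsto_pd i)

theorem congr (h : ApproxBy Ω φ p P) (hp : p =ᵐ[volume.restrict Ω] q)
    (hP : ∀ i, P i =ᵐ[volume.restrict Ω] Q i) : ApproxBy Ω φ q Q where
  smooth := h.smooth
  tendsto := h.tendsto.congr_lim hp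
  tendsto_pd i := (h.tendsto_pd i).congr_lim (hP i)

end ApproxBy

/-! ### Integration by parts on a box for limits of smooth functions -/

section IntegrationByParts

variable {n : ℕ} {lo hi : Fin (n + 1) → ℝ} {i : Fin (n + 1)} {c : ℝ}
  {p q : (Fin (n + 1) → ℝ) → ℝ} {P Q : Fin (n + 1) → (Fin (n + 1) → ℝ) → ℝ}
  {φ : ℕ → (Fin (n + 1) → ℝ) → ℝ}

theorem HasTrace.sub {h k : (Fin n → ℝ) → ℝ} (hp : HasTrace lo hi i c p P h)
    (hq : HasTrace lo hi i c q Q k) :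
    HasTrace lo hi i c (fun x => p x - q x) (fun i x => P i x - Q i x) (fun y => h y - k y) := by
  obtain ⟨φ, hφ, hh⟩ := hp
  obtain ⟨ψ, hψ, hk⟩ := hq
  exact ⟨_, hφ.sub hψ, hh.sub hk⟩

theorem HasTrace.congr {h : (Fin n → ℝ) → ℝ} (ht : HasTrace lo hi i c p P h)
    (hp : p =ᵐ[volume.restrict (box lo hi)] q)
    (hP : ∀ i, P i =ᵐ[volume.restrict (box lo hi)] Q i) : HasTrace lo hi i c q Q h := by
  obtain ⟨φ, hφ, hh⟩ := ht
  exact ⟨φ, hφ.congr hp hP, hh⟩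

theorem continuous_insertNth_const (i : Fin (n + 1)) (c : ℝ) :
    Continuous fun y : Fin n → ℝ => (i.insertNth c y : Fin (n + 1) → ℝ) :=
  continuous_const.finInsertNth i continuous_id

theorem tendsto_integral_pd_mul_add {ψ : (Fin (n + 1) → ℝ) → ℝ} (i : Fin (n + 1))
    (h : ApproxBy (box lo hi) φ p P) (hψ : ContDiff ℝ ∞ ψ) :
    Tendsto (fun k => ∫ x in box lo hi, pd i (fun x => ψ x * φ k x) x) atTop
      (𝓝 (∫ x in box lo hi, (pd i ψ x * p x + ψ x * P i x))) := by
  have m1 := memLp_of_continuous (lo := lo) (hi := hi) (contDiff_pd i hψ).continuous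
  have m2 := memLp_of_continuous (lo := lo) (hi := hi) hψ.continuous
  have t1 := (L2Tendsto.const m1).integral_mul h.tendsto
  have t2 := (L2Tendsto.const m2).integral_mul (h.tendsto_pd i)
  rw [integral_add (integrable_mul_of_memLp m1 h.memLp) (integrable_mul_of_memLp m2 (h.memLp_pd i))]
  refine (t1.add t2).congr fun k => ?_
  rw [← integral_add (integrable_mul_of_memLp m1 (h.tendsto.memLp k))
    (integrable_mul_of_memLp m2 ((h.tendsto_pd i).memLp k))]
  exact integral_congr_ae (ae_of_all _ fun x => (pd_mul i hψ (h.smooth k) x).symm)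

/-- Integration by parts against a smooth function that vanishes on both faces. -/
theorem ApproxBy.integral_pd_mul_add_eq_zero (hle : lo ≤ hi) {ψ : (Fin (n + 1) → ℝ) → ℝ}
    (h : ApproxBy (box lo hi) φ p P) (hψ : ContDiff ℝ ∞ ψ)
    (h0 : ∀ x, (x i = lo i ∨ x i = hi i) → ψ x = 0) :
    ∫ x in box lo hi, (pd i ψ x * p x + ψ x * P i x) = 0 := by
  refine tendsto_nhds_unique (tendsto_integral_pd_mul_add i h hψ) ?_
  refine tendsto_const_nhds.congr fun k => ?_
  rw [integral_pd hle i (hψ.mul (h.smooth k))]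
  have e1 : ∀ y : Fin n → ℝ, ψ (i.insertNth (hi i) y) = 0 := fun y => h0 _ (by simp)
  have e2 : ∀ y : Fin n → ℝ, ψ (i.insertNth (lo i) y) = 0 := fun y => h0 _ (by simp)
  simp [e1, e2]

/-- The divergence theorem for `ψ * φ k` leaves one face integral at `xᵢ = c`, which tends to that
of `ψ` times the zero trace; `ψ` kills the opposite face. -/
theorem HasTrace.weakZeroTrace (hle : lo ≤ hi) (hlt : lo i ≠ hi i) (hc : c = lo i ∨ c = hi i)
    (h : HasTrace lo hi i c p P 0) : WeakZeroTrace lo hi i c p (P i) := by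
  intro ψ hψ h0
  obtain ⟨φ, hφ, hh⟩ := h
  refine tendsto_nhds_unique (tendsto_integral_pd_mul_add i hφ hψ) ?_
  have t := (L2Tendsto.const (memLp_of_continuous (lo := i.removeNth lo) (hi := i.removeNth hi)
    (hψ.continuous.comp (continuous_insertNth_const i c)))).integral_mul hh
  simp only [Pi.zero_apply, mul_zero, integral_zero, Function.comp_apply] at t
  rcases hc with rfl | rfl
  · have e1 : ∀ y : Fin n → ℝ, ψ (i.insertNth (hi i) y) = 0 := fun y =>
      h0 _ (by simp) (by simpa using hlt.symm)
    have t' := t.neg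
    rw [neg_zero] at t'
    refine t'.congr fun k => ?_
    rw [integral_pd hle i (hψ.mul (hφ.smooth k))]
    simp [e1]
  · have e1 : ∀ y : Fin n → ℝ, ψ (i.insertNth (lo i) y) = 0 := fun y =>
      h0 _ (by simp) (by simpa using hlt)
    refine t.congr fun k => ?_
    rw [integral_pd hle i (hψ.mul (hφ.smooth k))]
    simp [e1]

/-- The cutoff functions `(1 - e^{-k (xⱼ - lo j)}) (1 - e^{-k (hi j - xⱼ)})`. -/
noncomputable def cutoff {n : ℕ} (lo hi : Fin n → ℝ) (j : Fin n) (k : ℕ) (x : Fin n → ℝ) : ℝ :=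
  (1 - Real.exp (-k * (x j - lo j))) * (1 - Real.exp (-k * (hi j - x j)))

theorem contDiff_cutoff (j : Fin (n + 1)) (k : ℕ) : ContDiff ℝ ∞ (cutoff lo hi j k) := by
  unfold cutoff
  fun_prop

theorem cutoff_eq_zero {j : Fin (n + 1)} {k : ℕ} {x : Fin (n + 1) → ℝ}
    (h : x j = lo j ∨ x j = hi j) : cutoff lo hi j k x = 0 := by
  rcases h with h | h <;> simp [cutoff, h]

theorem abs_cutoff_le_one {j : Fin (n + 1)} {k : ℕ} {x : Fin (n + 1) → ℝ} (hx : x ∈ box lo hi) :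
    |cutoff lo hi j k x| ≤ 1 := by
  have aux : ∀ s : ℝ, 0 < s → |1 - Real.exp (-k * s)| ≤ 1 := fun s hs => by
    have h1 := Real.exp_pos (-k * s)
    have h2 : Real.exp (-k * s) ≤ 1 := Real.exp_le_one_iff.2 (by
      have := mul_nonneg (Nat.cast_nonneg (α := ℝ) k) hs.le
      linarith)
    rw [abs_le]
    constructor <;> linarith
  rw [cutoff, abs_mul]
  exact mul_le_one₀ (aux _ (sub_pos.2 (hx j).1)) (abs_nonneg _) (aux _ (sub_pos.2 (hx j).2))

theorem tendsto_cutoff {j : Fin (n + 1)} {x : Fin (n + 1) → ℝ} (hx : x ∈ box lo hi) :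
    Tendsto (fun k => cutoff lo hi j k x) atTop (𝓝 1) := by
  have aux : ∀ s : ℝ, 0 < s → Tendsto (fun k : ℕ => 1 - Real.exp (-k * s)) atTop (𝓝 1) := by
    intro s hs
    have h1 : Tendsto (fun k : ℕ => -(k : ℝ) * s) atTop atBot := by
      have := (tendsto_natCast_atTop_atTop (R := ℝ)).atTop_mul_const hs
      exact (tendsto_neg_atTop_atBot.comp this).congr fun k => by simp
    simpa using (Real.tendsto_exp_atBot.comp h1).const_sub 1
  simpa [cutoff] using (aux _ (sub_pos.2 (hx j).1)).mul (aux _ (sub_pos.2 (hx j).2))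

/-- If `p` vanishes on a face, then so do its tangential derivatives. -/
theorem HasTrace.weakZeroTrace_tangential (hlt : ∀ i, lo i < hi i)
    (hc : c = lo i ∨ c = hi i) {j : Fin (n + 1)} (hij : i ≠ j)
    (h : HasTrace lo hi i c p P 0) {R : Fin (n + 1) → (Fin (n + 1) → ℝ) → ℝ}
    (hi' : ApproxBy (box lo hi) φ (P i) Q) (hPj : MemLp (P j) 2 (volume.restrict (box lo hi)))
    (hR : R i =ᵐ[volume.restrict (box lo hi)] Q j) :
    WeakZeroTrace lo hi i c (P j) (R i) := by
  intro ψ hψ h0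
  have hle : lo ≤ hi := fun i => (hlt i).le
  have hRi : MemLp (R i) 2 (volume.restrict (box lo hi)) :=
    (memLp_congr_ae hR).2 (hi'.memLp_pd j)
  have hw := h.weakZeroTrace hle (hlt i).ne hc
  obtain ⟨ξ, hξ, -⟩ := h
  -- No trace of `p` is known on the faces `xⱼ = lo j`, `xⱼ = hi j`, so the identity is first proved
  -- for a test function cut off near them.
  have step : ∀ k, ∫ x in box lo hi,
      cutoff lo hi j k x * (pd i ψ x * P j x + ψ x * R i x) = 0 := by
    intro k
    have hη : ContDiff ℝ ∞ (cutoff lo hi j k) := contDiff_cutoff j k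
    set Ψ : (Fin (n + 1) → ℝ) → ℝ := fun x => cutoff lo hi j k x * ψ x with hΨ
    have cΨ : ContDiff ℝ ∞ Ψ := hη.mul hψ
    have ci := contDiff_pd i cΨ
    have cj := contDiff_pd j cΨ
    have cij := contDiff_pd j ci
    have z1 : ∀ x, (x j = lo j ∨ x j = hi j) → Ψ x = 0 := fun x hx => by
      simp [hΨ, cutoff_eq_zero hx]
    have z2 : ∀ x, (x j = lo j ∨ x j = hi j) → pd i Ψ x = 0 := by
      rintro x (hx | hx)
      · exact pd_eq_zero_of_face hij cΨ (fun y hy => z1 y (Or.inl hy)) hx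
      · exact pd_eq_zero_of_face hij cΨ (fun y hy => z1 y (Or.inr hy)) hx
    have z3 : ∀ x, (x i = lo i ∨ x i = hi i) → x i ≠ c → pd j Ψ x = 0 := by
      intro x hx hxc
      refine pd_eq_zero_of_face hij.symm cΨ (c := x i) (fun y hy => ?_) rfl
      simp [hΨ, h0 y (by rwa [hy]) (by rwa [hy])]
    -- With `Ψ` the cut-off test function, three integrations by parts give `∫ ∂ᵢΨ ∂ⱼp = -∫ ∂ⱼ∂ᵢΨ p
    -- = ∫ ∂ⱼΨ ∂ᵢp = -∫ Ψ ∂ⱼ∂ᵢp`. Only the middle one uses the zero trace of `p`.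
    have i1 := hξ.integral_pd_mul_add_eq_zero hle ci z2
    have i2 := hw _ cj z3
    have i3 := hi'.integral_pd_mul_add_eq_zero hle cΨ z1
    have M : ∀ {m : (Fin (n + 1) → ℝ) → ℝ}, ContDiff ℝ ∞ m →
        MemLp m 2 (volume.restrict (box lo hi)) := fun hm => memLp_of_continuous hm.continuous
    rw [pd_comm i j cΨ] at i2
    rw [integral_add (integrable_mul_of_memLp (M cij) hξ.memLp)
      (integrable_mul_of_memLp (M ci) hPj)] at i1
    rw [integral_add (integrable_mul_of_memLp (M cij) hξ.memLp)
      (integrable_mul_of_memLp (M cj) hi'.memLp)] at i2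
    rw [integral_add (integrable_mul_of_memLp (M cj) hi'.memLp)
      (integrable_mul_of_memLp (M cΨ) (hi'.memLp_pd j))] at i3
    have e : ∫ x in box lo hi, cutoff lo hi j k x * (pd i ψ x * P j x + ψ x * R i x) =
        ∫ x in box lo hi, (pd i Ψ x * P j x + Ψ x * Q j x) := by
      refine integral_congr_ae ?_
      filter_upwards [hR] with x hx
      -- The cutoff depends on `xⱼ` alone, so the identity contains no derivative of it that could
      -- blow up as `k → ∞`.
      have hz : pd i (cutoff lo hi j k) x = 0 :=
        pd_eq_zero_of_line hη fun t => by simp [cutoff, hij.symm]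
      rw [hx, hΨ, pd_mul i hη hψ, hz]
      ring
    rw [e, integral_add (integrable_mul_of_memLp (M ci) hPj)
      (integrable_mul_of_memLp (M cΨ) (hi'.memLp_pd j))]
    linarith
  have mi := contDiff_pd i hψ
  have I : Integrable (fun x => pd i ψ x * P j x + ψ x * R i x) (volume.restrict (box lo hi)) :=
    (integrable_mul_of_memLp (memLp_of_continuous mi.continuous) hPj).add
      (integrable_mul_of_memLp (memLp_of_continuous hψ.continuous) hRi)
  have lim : Tendsto (fun k => ∫ x in box lo hi,
      cutoff lo hi j k x * (pd i ψ x * P j x + ψ x * R i x)) atTop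
      (𝓝 (∫ x in box lo hi, (pd i ψ x * P j x + ψ x * R i x))) := by
    refine tendsto_integral_of_dominated_convergence
      (fun x => ‖pd i ψ x * P j x + ψ x * R i x‖) (fun k => ?_) I.norm (fun k => ?_) ?_
    · exact ((contDiff_cutoff j k).continuous.aestronglyMeasurable).mul I.1
    · refine (ae_restrict_iff' isOpen_box.measurableSet).2 (ae_of_all _ fun x hx => ?_)
      rw [norm_mul]
      exact mul_le_of_le_one_left (norm_nonneg _) (abs_cutoff_le_one hx)
    · refine (ae_restrict_iff' isOpen_box.measurableSet).2 (ae_of_all _ fun x hx => ?_)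
      simpa using (tendsto_cutoff (j := j) hx).mul_const (pd i ψ x * P j x + ψ x * R i x)
  simp only [step] at lim
  exact tendsto_nhds_unique lim tendsto_const_nhds

/-- The weighted inner product `∫ χ f g` over a box. -/
noncomputable def weightedInner {n : ℕ} (lo hi : Fin n → ℝ) (χ f g : (Fin n → ℝ) → ℝ) : ℝ :=
  ∫ x in box lo hi, χ x * f x * g x

/-- Integration by parts of a product. -/
theorem WeakZeroTrace.integral_mul {p' χ : (Fin (n + 1) → ℝ) → ℝ}
    (h : WeakZeroTrace lo hi i c p p') (hp : MemLp p 2 (volume.restrict (box lo hi)))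
    (hp' : MemLp p' 2 (volume.restrict (box lo hi))) (hq : ApproxBy (box lo hi) φ q Q)
    (hχ : ContDiff ℝ ∞ χ) (h0 : ∀ x, (x i = lo i ∨ x i = hi i) → x i ≠ c → χ x = 0) :
    weightedInner lo hi (pd i χ) p q + weightedInner lo hi χ p (Q i) +
      weightedInner lo hi χ p' q = 0 := by
  have cχ := hχ.continuous
  have ci := (contDiff_pd i hχ).continuous
  have m1 := memLp_continuous_mul ci hp
  have m2 := memLp_continuous_mul cχ hp
  have m3 := memLp_continuous_mul cχ hp'
  have t := (((L2Tendsto.const m1).integral_mul hq.tendsto).add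
    ((L2Tendsto.const m2).integral_mul (hq.tendsto_pd i))).add
    ((L2Tendsto.const m3).integral_mul hq.tendsto)
  have e : ∀ f f' : (Fin (n + 1) → ℝ) → ℝ, MemLp f 2 (volume.restrict (box lo hi)) →
      MemLp f' 2 (volume.restrict (box lo hi)) →
      ∫ x in box lo hi, (pd i χ x * p x * f x + χ x * p x * f' x + χ x * p' x * f x) =
      (∫ x in box lo hi, pd i χ x * p x * f x) + (∫ x in box lo hi, χ x * p x * f' x) +
        ∫ x in box lo hi, χ x * p' x * f x := by
    intro f f' hf hf'
    have j1 := integrable_mul_of_memLp m1 hf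
    have j2 := integrable_mul_of_memLp m2 hf'
    rw [← integral_add j1 j2]
    exact integral_add (j1.add j2) (integrable_mul_of_memLp m3 hf)
  refine tendsto_nhds_unique t (tendsto_const_nhds.congr fun k => ?_)
  rw [← e _ _ (hq.tendsto.memLp k) ((hq.tendsto_pd i).memLp k)]
  -- Only `q` is approximated: `χ * φ k` is an admissible test function, and `p` enters through its
  -- weak identity.
  rw [← h (fun x => χ x * φ k x) (hχ.mul (hq.smooth k)) fun x hx hc => by simp [h0 x hx hc]]
  refine integral_congr_ae (ae_of_all _ fun x => ?_)
  simp only [pd_mul i hχ (hq.smooth k)]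
  ring

/-- The boundary term of a square on the face `xᵢ = lo i` has a sign. -/
theorem ApproxBy.integral_sq_nonpos (hle : lo ≤ hi) {χ : (Fin (n + 1) → ℝ) → ℝ}
    (hq : ApproxBy (box lo hi) φ q Q) (hχ : ContDiff ℝ ∞ χ)
    (h0 : ∀ x, x i = hi i → χ x = 0)
    (hpos : ∀ y ∈ box (i.removeNth lo) (i.removeNth hi), 0 ≤ χ (i.insertNth (lo i) y)) :
    weightedInner lo hi (pd i χ) q q + weightedInner lo hi χ q (Q i) +
      weightedInner lo hi χ (Q i) q ≤ 0 := by
  have cχ := hχ.continuous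
  have ci := (contDiff_pd i hχ).continuous
  have t := (((hq.tendsto.continuous_mul ci).integral_mul hq.tendsto).add
    ((hq.tendsto.continuous_mul cχ).integral_mul (hq.tendsto_pd i))).add
    (((hq.tendsto_pd i).continuous_mul cχ).integral_mul hq.tendsto)
  have e : ∀ f f' : (Fin (n + 1) → ℝ) → ℝ, MemLp f 2 (volume.restrict (box lo hi)) →
      MemLp f' 2 (volume.restrict (box lo hi)) →
      ∫ x in box lo hi, (pd i χ x * f x * f x + χ x * f x * f' x + χ x * f' x * f x) =
      (∫ x in box lo hi, pd i χ x * f x * f x) + (∫ x in box lo hi, χ x * f x * f' x) +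
        ∫ x in box lo hi, χ x * f' x * f x := by
    intro f f' hf hf'
    have j1 := integrable_continuous_mul_mul ci hf hf
    have j2 := integrable_continuous_mul_mul cχ hf hf'
    rw [← integral_add j1 j2]
    exact integral_add (j1.add j2) (integrable_continuous_mul_mul cχ hf' hf)
  -- The sign holds for each smooth approximant and survives the limit, so the approximants need not
  -- converge on the face.
  refine le_of_tendsto' t fun k => ?_
  rw [← e _ _ (hq.tendsto.memLp k) ((hq.tendsto_pd i).memLp k)]
  have hk := hq.smooth k
  have e2 : ∫ x in box lo hi, (pd i χ x * φ k x * φ k x + χ x * φ k x * pd i (φ k) x +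
      χ x * pd i (φ k) x * φ k x) = ∫ x in box lo hi, pd i (fun x => χ x * (φ k x * φ k x)) x := by
    refine integral_congr_ae (ae_of_all _ fun x => ?_)
    simp only [pd_mul i hχ (hk.mul hk), pd_mul i hk hk]
    ring
  rw [e2, integral_pd hle i (hχ.mul (hk.mul hk))]
  have e1 : ∀ y : Fin n → ℝ, χ (i.insertNth (hi i) y) = 0 := fun y => h0 _ (by simp)
  simp only [e1, zero_mul, integral_zero, zero_sub, Left.neg_nonpos_iff]
  exact setIntegral_nonneg isOpen_box.measurableSet fun y hy =>
    mul_nonneg (hpos y hy) (mul_self_nonneg _)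

end IntegrationByParts

/-! ### Weak derivatives -/

section Weak

variable {n : ℕ} {Ω : Set (Fin n → ℝ)} {i j : Fin n} {u u' v v' : (Fin n → ℝ) → ℝ}

theorem integrable_mul_of_locallyIntegrableOn {g : (Fin n → ℝ) → ℝ}
    (hv : LocallyIntegrableOn v Ω volume) (hg : Continuous g) (hc : HasCompactSupport g)
    (hs : tsupport g ⊆ Ω) : Integrable (fun p => v p * g p) (volume.restrict Ω) := by
  have h1 : IntegrableOn v (tsupport g) volume := hv.integrableOn_compact_subset hs hc
  have h2 : IntegrableOn (fun p => v p * g p) (tsupport g) volume :=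
    h1.mul_continuousOn hg.continuousOn hc
  refine Integrable.restrict ?_
  refine (integrableOn_iff_integrable_of_support_subset ?_).1 h2
  exact (Function.support_mul_subset_right _ _).trans (subset_tsupport g)

/-- The fundamental lemma of the calculus of variations, applied to `v - v'`. -/
theorem HasWeakDeriv.ae_unique (hΩ : IsOpen Ω) (h : HasWeakDeriv Ω i u v)
    (h' : HasWeakDeriv Ω i u v') : v =ᵐ[volume.restrict Ω] v' := by
  have key : ∀ᵐ x, x ∈ Ω → v x - v' x = 0 := by
    refine hΩ.ae_eq_zero_of_integral_contDiff_smul_eq_zero (h.2.1.sub h'.2.1) fun g hg hc hs => ?_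
    have e := (h.2.2 g hg hc hs).symm.trans (h'.2.2 g hg hc hs)
    have i1 := integrable_mul_of_locallyIntegrableOn h.2.1 hg.continuous hc hs
    have i2 := integrable_mul_of_locallyIntegrableOn h'.2.1 hg.continuous hc hs
    rw [← setIntegral_eq_integral_of_forall_compl_eq_zero (s := Ω) fun x hx => by
      rw [image_eq_zero_of_notMem_tsupport fun hx' => hx (hs hx'), zero_smul]]
    have : ∫ x in Ω, g x • (v x - v' x) = (∫ x in Ω, v x * g x) - ∫ x in Ω, v' x * g x := by
      rw [← integral_sub i1 i2]
      refine integral_congr_ae (ae_of_all _ fun x => ?_)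
      simp only [smul_eq_mul]
      ring
    rw [this]
    linarith
  rw [EventuallyEq, ae_restrict_iff' hΩ.measurableSet]
  filter_upwards [key] with x hx hxΩ
  exact sub_eq_zero.1 (hx hxΩ)

theorem HasWeakDeriv.sub (h : HasWeakDeriv Ω i u v) (h' : HasWeakDeriv Ω i u' v') :
    HasWeakDeriv Ω i (fun p => u p - u' p) (fun p => v p - v' p) := by
  refine ⟨h.1.sub h'.1, h.2.1.sub h'.2.1, fun g hg hc hs => ?_⟩
  have cg := (contDiff_pd i hg).continuous
  have hs' : tsupport (pd i g) ⊆ Ω := (tsupport_fderiv_apply_subset ℝ _).trans hs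
  have hc' : HasCompactSupport (pd i g) := hc.fderiv_apply ℝ _
  have e1 := integral_sub (integrable_mul_of_locallyIntegrableOn h.1 cg hc' hs')
    (integrable_mul_of_locallyIntegrableOn h'.1 cg hc' hs')
  have e2 := integral_sub (integrable_mul_of_locallyIntegrableOn h.2.1 hg.continuous hc hs)
    (integrable_mul_of_locallyIntegrableOn h'.2.1 hg.continuous hc hs)
  have f1 := h.2.2 g hg hc hs
  have f2 := h'.2.2 g hg hc hs
  simp only [pd] at e1
  simp only [sub_mul]
  rw [e1, e2, f1, f2]
  ring

theorem HasWeakDeriv.neg (h : HasWeakDeriv Ω i u v) :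
    HasWeakDeriv Ω i (fun p => -u p) (fun p => -v p) := by
  refine ⟨h.1.neg, h.2.1.neg, fun g hg hc hs => ?_⟩
  simp only [neg_mul, integral_neg, h.2.2 g hg hc hs]

theorem HasWeakDeriv.add (h : HasWeakDeriv Ω i u v) (h' : HasWeakDeriv Ω i u' v') :
    HasWeakDeriv Ω i (fun p => u p + u' p) (fun p => v p + v' p) := by
  simpa using h.sub h'.neg

theorem locallyIntegrableOn_of_memLp {n : ℕ} {lo hi : Fin n → ℝ} {u : (Fin n → ℝ) → ℝ}
    (hu : MemLp u 2 (volume.restrict (box lo hi))) : LocallyIntegrableOn u (box lo hi) volume :=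
  IntegrableOn.locallyIntegrableOn (hu.integrable one_le_two)

theorem HasWeakDeriv.congr (h : HasWeakDeriv Ω i u v) (hu : LocallyIntegrableOn u' Ω volume)
    (he : u =ᵐ[volume.restrict Ω] u') : HasWeakDeriv Ω i u' v := by
  refine ⟨hu, h.2.1, fun g hg hc hs => ?_⟩
  rw [← h.2.2 g hg hc hs]
  refine integral_congr_ae ?_
  filter_upwards [he] with x hx
  rw [hx]

/-- The test function is supported in `Ω`, so both integrals extend to the whole space, where there
is no boundary term. -/
theorem hasWeakDeriv_of_contDiff (hu : ContDiff ℝ ∞ u) : HasWeakDeriv Ω i u (pd i u) := by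
  refine ⟨hu.continuous.locallyIntegrable.locallyIntegrableOn _,
    (contDiff_pd i hu).continuous.locallyIntegrable.locallyIntegrableOn _, fun g hg hc hs => ?_⟩
  have cg := (contDiff_pd i hg).continuous
  have cu := (contDiff_pd i hu).continuous
  have hc' : HasCompactSupport (pd i g) := hc.fderiv_apply ℝ _
  have z : ∀ x, x ∉ Ω → g x = 0 := fun x hx => image_eq_zero_of_notMem_tsupport fun h => hx (hs h)
  have z' : ∀ x, x ∉ Ω → pd i g x = 0 := fun x hx => image_eq_zero_of_notMem_tsupport fun h =>
    hx (hs (tsupport_fderiv_apply_subset ℝ _ h))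
  have e1 := setIntegral_eq_integral_of_forall_compl_eq_zero (μ := volume) (s := Ω)
    (f := fun x => u x * pd i g x) fun x hx => by rw [z' x hx, mul_zero]
  have e2 := setIntegral_eq_integral_of_forall_compl_eq_zero (μ := volume) (s := Ω)
    (f := fun x => pd i u x * g x) fun x hx => by rw [z x hx, mul_zero]
  refine e1.trans (Eq.trans ?_ (congrArg Neg.neg e2.symm))
  exact integral_mul_fderiv_eq_neg_fderiv_mul_of_integrable
    ((cu.mul hg.continuous).integrable_of_hasCompactSupport hc.mul_left)
    ((hu.continuous.mul cg).integrable_of_hasCompactSupport hc'.mul_left)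
    ((hu.continuous.mul hg.continuous).integrable_of_hasCompactSupport hc.mul_left)
    (fun x _ => hu.differentiable (by simp) x) (fun x _ => hg.differentiable (by simp) x)

/-- Both derivatives move onto the test function, where they commute classically. -/
theorem HasWeakDeriv.comm (hΩ : IsOpen Ω) {ui uj uij uji : (Fin n → ℝ) → ℝ}
    (hi : HasWeakDeriv Ω i u ui) (hj : HasWeakDeriv Ω j u uj) (hij : HasWeakDeriv Ω j ui uij)
    (hji : HasWeakDeriv Ω i uj uji) : uij =ᵐ[volume.restrict Ω] uji := by
  refine HasWeakDeriv.ae_unique hΩ hij ⟨hi.2.1, hji.2.1, fun g hg hc hs => ?_⟩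
  have sub : ∀ k, tsupport (pd k g) ⊆ Ω := fun k => (tsupport_fderiv_apply_subset ℝ _).trans hs
  have cs : ∀ k, HasCompactSupport (pd k g) := fun k => hc.fderiv_apply ℝ _
  have e1 := hi.2.2 (pd j g) (contDiff_pd j hg) (cs j) (sub j)
  have e2 := hj.2.2 (pd i g) (contDiff_pd i hg) (cs i) (sub i)
  have e3 := hji.2.2 g hg hc hs
  change ∫ p in Ω, u p * pd i (pd j g) p = _ at e1
  change ∫ p in Ω, u p * pd j (pd i g) p = _ at e2
  rw [pd_comm i j hg, e2] at e1
  rw [← e3]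
  exact (neg_injective e1).symm

end Weak

/-! ### Sobolev functions and the chosen weak derivatives -/

section MemHBox

variable {n : ℕ} {lo hi : Fin n → ℝ} {i j : Fin n} {u v : (Fin n → ℝ) → ℝ} {k : ℕ}

theorem MemH.memLp {Ω : Set (Fin n → ℝ)} (h : MemH Ω k u) : MemLp u 2 (volume.restrict Ω) := by
  cases k with
  | zero => exact h
  | succ k => exact h.1

theorem MemH.congr (h : MemH (box lo hi) k u) (he : u =ᵐ[volume.restrict (box lo hi)] v) :
    MemH (box lo hi) k v := by
  have hv := (memLp_congr_ae he).1 h.memLp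
  cases k with
  | zero => exact hv
  | succ k =>
    refine ⟨hv, fun i => ?_⟩
    obtain ⟨w, hw, hw'⟩ := h.2 i
    exact ⟨w, hw.congr (locallyIntegrableOn_of_memLp hv) he, hw'⟩

theorem HasWeakDeriv.weakDeriv {Ω : Set (Fin n → ℝ)} (h : HasWeakDeriv Ω i u v) :
    HasWeakDeriv Ω i u (weakDeriv Ω i u) :=
  Classical.epsilon_spec (p := HasWeakDeriv Ω i u) ⟨v, h⟩

theorem HasWeakDeriv.weakDeriv_ae_eq {Ω : Set (Fin n → ℝ)} (hΩ : IsOpen Ω)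
    (h : HasWeakDeriv Ω i u v) : TimeReversal.weakDeriv Ω i u =ᵐ[volume.restrict Ω] v :=
  h.weakDeriv.ae_unique hΩ h

theorem MemH.hasWeakDeriv {Ω : Set (Fin n → ℝ)} (h : MemH Ω (k + 1) u) (i : Fin n) :
    HasWeakDeriv Ω i u (weakDeriv Ω i u) := by
  obtain ⟨v, hv, -⟩ := h.2 i
  exact hv.weakDeriv

theorem MemH.weakDeriv (h : MemH (box lo hi) (k + 1) u) (i : Fin n) :
    MemH (box lo hi) k (weakDeriv (box lo hi) i u) := by
  obtain ⟨v, hv, hv'⟩ := h.2 i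
  exact hv'.congr (hv.weakDeriv_ae_eq isOpen_box).symm

theorem l2NormSq_nonneg (Ω : Set (Fin n → ℝ)) (u : (Fin n → ℝ) → ℝ) : 0 ≤ l2NormSq Ω u :=
  integral_nonneg fun _ => sq_nonneg _

theorem sq_h1Norm (Ω : Set (Fin n → ℝ)) (u : (Fin n → ℝ) → ℝ) :
    h1Norm Ω u ^ 2 = l2NormSq Ω u + ∑ i, l2NormSq Ω (TimeReversal.weakDeriv Ω i u) :=
  Real.sq_sqrt (add_nonneg (l2NormSq_nonneg _ _) (Finset.sum_nonneg fun _ _ => l2NormSq_nonneg _ _))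

end MemHBox

/-- A trace in the sense of `IsTrace`, with the weak derivatives as gradient. -/
theorem IsTrace.hasTrace {n : ℕ} {lo hi : Fin (n + 1) → ℝ} {i : Fin (n + 1)} {c : ℝ}
    {v : (Fin (n + 1) → ℝ) → ℝ} {h : (Fin n → ℝ) → ℝ} (ht : IsTrace lo hi i c v h) :
    HasTrace lo hi i c v (fun j => weakDeriv (box lo hi) j v) h := by
  obtain ⟨hv, hh, φ, hφ, h1, h2⟩ := ht
  have h1' : Tendsto (fun k => l2NormSq (box lo hi) (fun p => φ k p - v p) +
      ∑ j, l2NormSq (box lo hi) (weakDeriv (box lo hi) j fun p => φ k p - v p)) atTop (𝓝 0) := by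
    simpa [sq_h1Norm] using h1.pow 2
  refine ⟨φ, ⟨hφ, ⟨fun k => memLp_of_continuous (hφ k).continuous, hv.memLp, ?_⟩, fun j =>
    ⟨fun k => memLp_of_continuous (contDiff_pd j (hφ k)).continuous, (hv.weakDeriv j).memLp, ?_⟩⟩,
    ⟨fun k => memLp_of_continuous ((hφ k).continuous.comp (continuous_insertNth_const i c)), hh, h2⟩⟩
  · refine squeeze_zero (fun k => l2NormSq_nonneg _ _) (fun k => ?_) h1'
    exact le_add_of_nonneg_right (Finset.sum_nonneg fun _ _ => l2NormSq_nonneg _ _)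
  · refine squeeze_zero (fun k => integral_nonneg fun _ => sq_nonneg _) (fun k => ?_) h1'
    refine le_trans ?_ (le_add_of_nonneg_left (l2NormSq_nonneg _ _))
    refine le_trans (le_of_eq ?_) (Finset.single_le_sum (f := fun j => l2NormSq (box lo hi)
      (weakDeriv (box lo hi) j fun p => φ k p - v p)) (fun _ _ => l2NormSq_nonneg _ _)
      (Finset.mem_univ j))
    refine integral_congr_ae ?_
    -- The `H¹` norm sees an arbitrarily chosen weak derivative of `φ k - v`; uniqueness identifies
    -- it with the difference of the derivatives.
    filter_upwards [((hasWeakDeriv_of_contDiff (hφ k)).sub (hv.hasWeakDeriv j)).weakDeriv_ae_eq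
      isOpen_box] with x hx
    rw [hx]

/-! ### The energy estimate -/

section WeightedInner

variable {n : ℕ} {lo hi : Fin n → ℝ} {θ χ χ' f f' g : (Fin n → ℝ) → ℝ}

theorem weightedInner_comm (χ f g : (Fin n → ℝ) → ℝ) :
    weightedInner lo hi χ f g = weightedInner lo hi χ g f :=
  integral_congr_ae (ae_of_all _ fun x => by ring)

theorem weightedInner_congr_right (χ f : (Fin n → ℝ) → ℝ) {g g' : (Fin n → ℝ) → ℝ}
    (h : g =ᵐ[volume.restrict (box lo hi)] g') :
    weightedInner lo hi χ f g = weightedInner lo hi χ f g' := by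
  refine integral_congr_ae ?_
  filter_upwards [h] with x hx
  rw [hx]

theorem weightedInner_sub_left (hχ : Continuous χ) (hf : MemLp f 2 (volume.restrict (box lo hi)))
    (hf' : MemLp f' 2 (volume.restrict (box lo hi)))
    (hg : MemLp g 2 (volume.restrict (box lo hi))) :
    weightedInner lo hi χ (fun x => f x - f' x) g =
      weightedInner lo hi χ f g - weightedInner lo hi χ f' g := by
  unfold weightedInner
  rw [← integral_sub (integrable_continuous_mul_mul hχ hf hg)
    (integrable_continuous_mul_mul hχ hf' hg)]
  exact integral_congr_ae (ae_of_all _ fun x => by simp only; ring)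

theorem weightedInner_neg_add_left (hχ : Continuous χ)
    (hf : MemLp f 2 (volume.restrict (box lo hi))) (hf' : MemLp f' 2 (volume.restrict (box lo hi)))
    (hg : MemLp g 2 (volume.restrict (box lo hi))) :
    weightedInner lo hi χ (fun x => -f x + f' x) g =
      weightedInner lo hi χ f' g - weightedInner lo hi χ f g := by
  rw [← weightedInner_sub_left hχ hf' hf hg]
  exact integral_congr_ae (ae_of_all _ fun x => by simp only; ring)

/-- Recombines the weights `θ (hi i - xᵢ)` and `θ (xᵢ - lo i)`, with `c = hi i - lo i`, and cancels
their `i`-th derivatives, with `c = 0`. -/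
theorem weightedInner_add_weight {c : ℝ} (hχ : Continuous χ) (hχ' : Continuous χ')
    (h : ∀ x, χ x + χ' x = c * θ x)
    (hf : MemLp f 2 (volume.restrict (box lo hi))) (hg : MemLp g 2 (volume.restrict (box lo hi))) :
    weightedInner lo hi χ f g + weightedInner lo hi χ' f g = c * weightedInner lo hi θ f g := by
  unfold weightedInner
  rw [← integral_add (integrable_continuous_mul_mul hχ hf hg)
    (integrable_continuous_mul_mul hχ' hf hg), ← integral_const_mul]
  refine integral_congr_ae (ae_of_all _ fun x => ?_)
  linear_combination (f x * g x) * h x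

end WeightedInner

section Weights

variable {n : ℕ}

theorem pd_const_sub_coord (i : Fin n) (c : ℝ) (x : Fin n → ℝ) : pd i (fun x => c - x i) x = -1 := by
  have h : HasFDerivAt (fun x : Fin n → ℝ => c - x i)
      (-(ContinuousLinearMap.proj i : (Fin n → ℝ) →L[ℝ] ℝ)) x :=
    (hasFDerivAt_apply i x).const_sub c
  simp [pd, h.fderiv]

theorem pd_coord_sub_const (i : Fin n) (c : ℝ) (x : Fin n → ℝ) : pd i (fun x => x i - c) x = 1 := by
  have h : HasFDerivAt (fun x : Fin n → ℝ => x i - c)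
      (ContinuousLinearMap.proj i : (Fin n → ℝ) →L[ℝ] ℝ) x :=
    (hasFDerivAt_apply i x).sub_const c
  simp [pd, h.fderiv]

theorem pd_const_sub_coord_of_ne {i j : Fin n} (hij : i ≠ j) (c : ℝ) (x : Fin n → ℝ) :
    pd i (fun x => c - x j) x = 0 :=
  pd_eq_zero_of_line (by fun_prop) fun t => by simp [hij.symm]

end Weights

/-! ### Weighted identities, one for each type of boundary condition -/

section Identities

variable {n : ℕ} {lo hi : Fin (n + 1) → ℝ} {i : Fin (n + 1)}
  {p p' q θ : (Fin (n + 1) → ℝ) → ℝ} {P Q : Fin (n + 1) → (Fin (n + 1) → ℝ) → ℝ}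
  {φ : ℕ → (Fin (n + 1) → ℝ) → ℝ}

/-- If `p` vanishes on the face `xᵢ = lo i`, then `‖p‖² = 2 ∫ (hi i - xᵢ) p ∂ᵢp`. -/
theorem WeakZeroTrace.integral_sq_eq (h : WeakZeroTrace lo hi i (lo i) p (P i))
    (hp : ApproxBy (box lo hi) φ p P) :
    ∫ x in box lo hi, p x ^ 2 = 2 * weightedInner lo hi (fun x => hi i - x i) p (P i) := by
  -- This weight vanishes on the face where nothing is known about `p`, and its derivative `-1`
  -- produces `-∫ p²`.
  have e := h.integral_mul (χ := fun x => hi i - x i) hp.memLp (hp.memLp_pd i) hp (by fun_prop)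
    fun x hx hne => by
      rcases hx with hx | hx
      · exact absurd hx hne
      · simp [hx]
  rw [weightedInner_comm _ (P i) p] at e
  have e2 : weightedInner lo hi (pd i fun x => hi i - x i) p p = -∫ x in box lo hi, p x ^ 2 := by
    rw [← integral_neg]
    refine integral_congr_ae (ae_of_all _ fun x => ?_)
    simp only [pd_const_sub_coord]
    ring
  linarith

/-- Integration by parts when `p` vanishes on both faces. -/
theorem WeakZeroTrace.integral_mul_of_both (hlt : lo i < hi i)
    (h : WeakZeroTrace lo hi i (lo i) p p') (h' : WeakZeroTrace lo hi i (hi i) p p')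
    (hp : MemLp p 2 (volume.restrict (box lo hi))) (hp' : MemLp p' 2 (volume.restrict (box lo hi)))
    (hq : ApproxBy (box lo hi) φ q Q) (hθ : ContDiff ℝ ∞ θ) (hθi : ∀ x, pd i θ x = 0) :
    weightedInner lo hi θ p (Q i) + weightedInner lo hi θ p' q = 0 := by
  -- A weak zero trace handles one face at a time, so `(hi i - lo i) θ` is split into two weights,
  -- each vanishing on one face.
  have c1 : ContDiff ℝ ∞ fun x : Fin (n + 1) → ℝ => hi i - x i := by fun_prop
  have c2 : ContDiff ℝ ∞ fun x : Fin (n + 1) → ℝ => x i - lo i := by fun_prop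
  have k1 := hθ.mul c1
  have k2 := hθ.mul c2
  have e1 := h.integral_mul hp hp' hq k1 fun x hx hne => by
    rcases hx with hx | hx
    · exact absurd hx hne
    · simp [hx]
  have e2 := h'.integral_mul hp hp' hq k2 fun x hx hne => by
    rcases hx with hx | hx
    · simp [hx]
    · exact absurd hx hne
  have hs : ∀ x, θ x * (hi i - x i) + θ x * (x i - lo i) = (hi i - lo i) * θ x := fun x => by ring
  have s0 := weightedInner_add_weight (c := 0) (θ := θ) (contDiff_pd i k1).continuous
    (contDiff_pd i k2).continuous (fun x => by
      rw [pd_mul i hθ c1, pd_mul i hθ c2, pd_const_sub_coord, pd_coord_sub_const, hθi]; ring)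
    hp hq.memLp
  have s1 := weightedInner_add_weight k1.continuous k2.continuous hs hp (hq.memLp_pd i)
  have s2 := weightedInner_add_weight k1.continuous k2.continuous hs hp' hq.memLp
  have key : (hi i - lo i) * (weightedInner lo hi θ p (Q i) + weightedInner lo hi θ p' q) = 0 := by
    linear_combination e1 + e2 - s0 - s1 - s2
  exact (mul_eq_zero.1 key).resolve_left (sub_pos.2 hlt).ne'

/-- The boundary terms of `∂ᵢ(θ p q)` have a sign if `q - p` vanishes on the face `xᵢ = lo i` and
`q` vanishes on the face `xᵢ = hi i`. -/
theorem integral_mul_nonpos_of_absorbing (hlt : ∀ i, lo i < hi i) {ψ : ℕ → (Fin (n + 1) → ℝ) → ℝ}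
    (hp : ApproxBy (box lo hi) φ p P) (hq : ApproxBy (box lo hi) ψ q Q)
    (h : WeakZeroTrace lo hi i (lo i) (fun x => -p x + q x) (fun x => -P i x + Q i x))
    (h' : WeakZeroTrace lo hi i (hi i) q (Q i))
    (hθ : ContDiff ℝ ∞ θ) (hθi : ∀ x, pd i θ x = 0)
    (hpos : ∀ y ∈ box (i.removeNth lo) (i.removeNth hi), 0 ≤ θ (i.insertNth (lo i) y)) :
    weightedInner lo hi θ p (Q i) + weightedInner lo hi θ (P i) q ≤ 0 := by
  have c1 : ContDiff ℝ ∞ fun x : Fin (n + 1) → ℝ => hi i - x i := by fun_prop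
  have c2 : ContDiff ℝ ∞ fun x : Fin (n + 1) → ℝ => x i - lo i := by fun_prop
  have k1 := hθ.mul c1
  have k2 := hθ.mul c2
  have d1 := (contDiff_pd i k1).continuous
  -- At `xᵢ = lo i`, pairing `q - p` with `q` trades the boundary term of `p q` for that of `q²`,
  -- whose sign is `e3`; at `xᵢ = hi i`, `e2` uses that `q` vanishes.
  have e1 := h.integral_mul (hp.memLp.neg.add hq.memLp) ((hp.memLp_pd i).neg.add (hq.memLp_pd i))
    hq k1 fun x hx hne => by
      rcases hx with hx | hx
      · exact absurd hx hne
      · simp [hx]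
  have e2 := h'.integral_mul hq.memLp (hq.memLp_pd i) hp k2 fun x hx hne => by
    rcases hx with hx | hx
    · simp [hx]
    · exact absurd hx hne
  have e3 := hq.integral_sq_nonpos (i := i) (fun i => (hlt i).le) k1 (fun x hx => by simp [hx])
    fun y hy => by
      simpa using mul_nonneg (hpos y hy) (sub_pos.2 (hlt i)).le
  rw [weightedInner_neg_add_left d1 hp.memLp hq.memLp hq.memLp,
    weightedInner_neg_add_left k1.continuous hp.memLp hq.memLp (hq.memLp_pd i),
    weightedInner_neg_add_left k1.continuous (hp.memLp_pd i) (hq.memLp_pd i) hq.memLp] at e1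
  rw [weightedInner_comm _ q p, weightedInner_comm _ q (P i), weightedInner_comm _ (Q i) p] at e2
  have hs : ∀ x, θ x * (hi i - x i) + θ x * (x i - lo i) = (hi i - lo i) * θ x := fun x => by ring
  have s0 := weightedInner_add_weight (c := 0) (θ := θ) d1
    (contDiff_pd i k2).continuous (fun x => by
      rw [pd_mul i hθ c1, pd_mul i hθ c2, pd_const_sub_coord, pd_coord_sub_const, hθi]; ring)
    hp.memLp hq.memLp
  have s1 := weightedInner_add_weight k1.continuous k2.continuous hs hp.memLp (hq.memLp_pd i)
  have s2 := weightedInner_add_weight k1.continuous k2.continuous hs (hp.memLp_pd i) hq.memLp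
  have key : (hi i - lo i) * (weightedInner lo hi θ p (Q i) + weightedInner lo hi θ (P i) q) ≤ 0 := by
    linarith
  exact nonpos_of_mul_nonpos_right key (sub_pos.2 (hlt i))

end Identities

/-- `|∫ θ f g|` is controlled by `L²` norms when `0 ≤ θ ≤ T`. -/
theorem weightedInner_le {n : ℕ} {lo hi : Fin n → ℝ} {θ f g : (Fin n → ℝ) → ℝ} {T : ℝ}
    (hθ : Continuous θ) (hT : ∀ x ∈ box lo hi, 0 ≤ θ x ∧ θ x ≤ T)
    (hf : MemLp f 2 (volume.restrict (box lo hi))) (hg : MemLp g 2 (volume.restrict (box lo hi))) :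
    weightedInner lo hi θ f g ≤
      T ^ 2 * (∫ x in box lo hi, f x ^ 2) + 1 / 4 * ∫ x in box lo hi, g x ^ 2 := by
  have i1 := (integrable_sq_of_memLp hf).const_mul (T ^ 2)
  have i2 := (integrable_sq_of_memLp hg).const_mul (1 / 4)
  rw [← integral_const_mul, ← integral_const_mul, ← integral_add i1 i2]
  refine integral_mono_ae (integrable_continuous_mul_mul hθ hf hg) (i1.add i2) ?_
  refine (ae_restrict_iff' isOpen_box.measurableSet).2 (ae_of_all _ fun x hx => ?_)
  obtain ⟨h0, h1⟩ := hT x hx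
  have h2 : θ x ^ 2 * f x ^ 2 ≤ T ^ 2 * f x ^ 2 :=
    mul_le_mul_of_nonneg_right (pow_le_pow_left₀ h0 h1 2) (sq_nonneg _)
  simp only
  -- Young's inequality `θ f g ≤ θ² f² + g² / 4`; the factor `1/4` is small enough to be absorbed in
  -- the energy estimate.
  nlinarith [sq_nonneg (θ x * f x - g x / 2)]

/-- The energy estimate for the wave equation with absorbing condition on `x₂ = lo 2`, Dirichlet
condition on `x₂ = hi 2`, Neumann conditions on the lateral faces, and zero initial data. -/
theorem energy_estimate {lo hi : Fin 4 → ℝ} (hlt : ∀ i, lo i < hi i)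
    {w f : (Fin 4 → ℝ) → ℝ} {W : Fin 4 → (Fin 4 → ℝ) → ℝ} {H : Fin 4 → Fin 4 → (Fin 4 → ℝ) → ℝ}
    (hinit : HasTrace lo hi 3 (lo 3) w W 0) (hinit' : HasTrace lo hi 3 (lo 3) (W 3) (H 3) 0)
    (hdir : HasTrace lo hi 2 (hi 2) w W 0)
    (habs : HasTrace lo hi 2 (lo 2) (fun x => -W 2 x + W 3 x) (fun j x => -H 2 j x + H 3 j x) 0)
    (h0lo : HasTrace lo hi 0 (lo 0) (W 0) (H 0) 0) (h0hi : HasTrace lo hi 0 (hi 0) (W 0) (H 0) 0)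
    (h1lo : HasTrace lo hi 1 (lo 1) (W 1) (H 1) 0) (h1hi : HasTrace lo hi 1 (hi 1) (W 1) (H 1) 0)
    (hsymm : ∀ i j, H i j =ᵐ[volume.restrict (box lo hi)] H j i)
    (hf : MemLp f 2 (volume.restrict (box lo hi)))
    (hwave : ∀ᵐ x ∂volume.restrict (box lo hi), H 3 3 x - H 0 0 x - H 1 1 x - H 2 2 x = f x) :
    ∑ i, ∫ x in box lo hi, W i x ^ 2 ≤ 4 * (hi 3 - lo 3) ^ 2 * ∫ x in box lo hi, f x ^ 2 ∧
    ∫ x in box lo hi, w x ^ 2 ≤ 4 * (hi 3 - lo 3) ^ 2 * ∫ x in box lo hi, W 3 x ^ 2 := by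
  have hle : lo ≤ hi := fun i => (hlt i).le
  obtain ⟨φw, aw, -⟩ := id hinit
  obtain ⟨φ3, a3, -⟩ := id hinit'
  obtain ⟨φ0, a0, -⟩ := id h0lo
  obtain ⟨φ1, a1, -⟩ := id h1lo
  -- No condition concerns `W 2` alone, so it is approximated as `W 3 - (-W 2 + W 3)`.
  obtain ⟨φ2, a2⟩ : ∃ φ, ApproxBy (box lo hi) φ (W 2) (H 2) := by
    obtain ⟨φ, hφ, -⟩ := habs
    exact ⟨_, (a3.sub hφ).congr (ae_of_all _ fun x => by ring)
      fun j => ae_of_all _ fun x => by ring⟩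
  set θ : (Fin 4 → ℝ) → ℝ := fun x => hi 3 - x 3 with hθ
  have cθ : ContDiff ℝ ∞ θ := by rw [hθ]; fun_prop
  have bθ : ∀ x ∈ box lo hi, 0 ≤ θ x ∧ θ x ≤ hi 3 - lo 3 := fun x hx =>
    ⟨(sub_pos.2 (hx 3).2).le, by have := (hx 3).1; simp only [hθ]; linarith⟩
  -- The spatial derivatives vanish at the initial time because `w` does; likewise `n2` gets `w_τ =
  -- 0` on `x₂ = hi 2` from the Dirichlet condition.
  have t3 : ∀ j, 3 ≠ j → WeakZeroTrace lo hi 3 (lo 3) (W j) (H j 3) := fun j hj =>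
    hinit.weakZeroTrace_tangential hlt (Or.inl rfl) hj a3 (aw.memLp_pd j) (hsymm j 3)
  have zw := (hinit.weakZeroTrace hle (hlt 3).ne (Or.inl rfl)).integral_sq_eq aw
  have z3 := (hinit'.weakZeroTrace hle (hlt 3).ne (Or.inl rfl)).integral_sq_eq a3
  have z0 := (t3 0 (by decide)).integral_sq_eq a0
  have z1 := (t3 1 (by decide)).integral_sq_eq a1
  have z2 := (t3 2 (by decide)).integral_sq_eq a2
  have n0 := (h0lo.weakZeroTrace hle (hlt 0).ne (Or.inl rfl)).integral_mul_of_both (hlt 0)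
    (h0hi.weakZeroTrace hle (hlt 0).ne (Or.inr rfl)) a0.memLp (a0.memLp_pd 0) a3 cθ
    (pd_const_sub_coord_of_ne (by decide) _)
  have n1 := (h1lo.weakZeroTrace hle (hlt 1).ne (Or.inl rfl)).integral_mul_of_both (hlt 1)
    (h1hi.weakZeroTrace hle (hlt 1).ne (Or.inr rfl)) a1.memLp (a1.memLp_pd 1) a3 cθ
    (pd_const_sub_coord_of_ne (by decide) _)
  have n2 := integral_mul_nonpos_of_absorbing hlt a2 a3
    (habs.weakZeroTrace hle (hlt 2).ne (Or.inl rfl))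
    (hdir.weakZeroTrace_tangential hlt (Or.inr rfl) (by decide) a2 (aw.memLp_pd 3) (hsymm 3 2)) cθ
    (pd_const_sub_coord_of_ne (by decide) _) (fun y hy => by
      have h := (hy 2).2
      -- On a face of constant `x₂` the remaining coordinates are renumbered, and time has index
      -- `2`.
      have e1 : (3 : Fin 4) = (2 : Fin 4).succAbove 2 := by decide
      simp only [hθ]
      rw [e1, Fin.insertNth_apply_succAbove]
      exact (sub_pos.2 h).le)
  have ef : weightedInner lo hi θ f (W 3) = weightedInner lo hi θ (H 3 3) (W 3) -
      weightedInner lo hi θ (H 0 0) (W 3) - weightedInner lo hi θ (H 1 1) (W 3) -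
      weightedInner lo hi θ (H 2 2) (W 3) := by
    have m33 := a3.memLp_pd 3
    have m00 := a0.memLp_pd 0
    have m11 := a1.memLp_pd 1
    have m22 := a2.memLp_pd 2
    have m30 : MemLp (fun x => H 3 3 x - H 0 0 x) 2 (volume.restrict (box lo hi)) := m33.sub m00
    have m31 : MemLp (fun x => H 3 3 x - H 0 0 x - H 1 1 x) 2 (volume.restrict (box lo hi)) :=
      m30.sub m11
    rw [← weightedInner_sub_left cθ.continuous m33 m00 a3.memLp,
      ← weightedInner_sub_left cθ.continuous m30 m11 a3.memLp,
      ← weightedInner_sub_left cθ.continuous m31 m22 a3.memLp,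
      weightedInner_comm, weightedInner_comm θ _ (W 3)]
    exact weightedInner_congr_right _ _ (hwave.mono fun x hx => hx.symm)
  have s0 := weightedInner_congr_right θ (W 0) (hsymm 3 0)
  have s1 := weightedInner_congr_right θ (W 1) (hsymm 3 1)
  have s2 := weightedInner_congr_right θ (W 2) (hsymm 3 2)
  have b1 := weightedInner_le cθ.continuous bθ hf a3.memLp
  have b2 := weightedInner_le cθ.continuous bθ a3.memLp aw.memLp
  rw [weightedInner_comm] at b2
  rw [weightedInner_comm θ (H 3 3)] at ef
  have p0 : 0 ≤ ∫ x in box lo hi, W 0 x ^ 2 := integral_nonneg fun _ => sq_nonneg _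
  have p1 : 0 ≤ ∫ x in box lo hi, W 1 x ^ 2 := integral_nonneg fun _ => sq_nonneg _
  have p2 : 0 ≤ ∫ x in box lo hi, W 2 x ^ 2 := integral_nonneg fun _ => sq_nonneg _
  rw [Fin.sum_univ_four]
  -- With `S = ∑ ∫ (W i)²`, the identities give `S / 2 ≤ ∫ θ f W₃ ≤ (hi 3 - lo 3)² ∫ f² + S / 4`.
  -- Similarly, `∫ w² = 2 ∫ θ w W₃` is at most `2 (hi 3 - lo 3)² ∫ W₃² + (∫ w²) / 2`.
  constructor <;> linarith

/-! ### Stability and uniqueness for the time-reversed problem -/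

theorem HasTrace.sub_of_eq {n : ℕ} {lo hi : Fin (n + 1) → ℝ} {i : Fin (n + 1)} {c : ℝ}
    {p q : (Fin (n + 1) → ℝ) → ℝ} {P Q : Fin (n + 1) → (Fin (n + 1) → ℝ) → ℝ}
    {h : (Fin n → ℝ) → ℝ} (hp : HasTrace lo hi i c p P h) (hq : HasTrace lo hi i c q Q h) :
    HasTrace lo hi i c (fun x => p x - q x) (fun i x => P i x - Q i x) 0 := by
  have e : (fun y => h y - h y) = 0 := by
    funext y
    simp
  exact e ▸ hp.sub hq

/-- The stability estimate for the difference of two functions that satisfy the boundary and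
initial conditions of the problem with the same Dirichlet data. -/
theorem stability_estimate {a b T : ℝ} (hba : b < a) (hT : 0 < T) {g : (Fin 3 → ℝ) → ℝ}
    {u v f : (Fin 4 → ℝ) → ℝ} (hu : MemH (QT a b T) 2 u) (hv : MemH (QT a b T) 2 v)
    (cu : HomogeneousConditions a b T u) (cv : HomogeneousConditions a b T v)
    (du : DirichletData a b T g u) (dv : DirichletData a b T g v)
    (hf : MemLp f 2 (volume.restrict (QT a b T)))
    (hwave : ∀ᵐ x ∂volume.restrict (QT a b T),
      (weakDeriv (QT a b T) 3 (weakDeriv (QT a b T) 3 u) x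
        - weakDeriv (QT a b T) 3 (weakDeriv (QT a b T) 3 v) x)
      - (weakDeriv (QT a b T) 0 (weakDeriv (QT a b T) 0 u) x
        - weakDeriv (QT a b T) 0 (weakDeriv (QT a b T) 0 v) x)
      - (weakDeriv (QT a b T) 1 (weakDeriv (QT a b T) 1 u) x
        - weakDeriv (QT a b T) 1 (weakDeriv (QT a b T) 1 v) x)
      - (weakDeriv (QT a b T) 2 (weakDeriv (QT a b T) 2 u) x
        - weakDeriv (QT a b T) 2 (weakDeriv (QT a b T) 2 v) x) = f x) :
    ∑ i, ∫ x in QT a b T, (weakDeriv (QT a b T) i u x - weakDeriv (QT a b T) i v x) ^ 2 ≤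
      4 * T ^ 2 * ∫ x in QT a b T, f x ^ 2 ∧
    ∫ x in QT a b T, (u x - v x) ^ 2 ≤ 4 * T ^ 2 *
      ∫ x in QT a b T, (weakDeriv (QT a b T) 3 u x - weakDeriv (QT a b T) 3 v x) ^ 2 := by
  have hO : IsOpen (QT a b T) := isOpen_box
  have hlt : ∀ i, qLo b i < qHi a T i := by
    intro i
    fin_cases i <;> simp [qLo, qHi, hba, hT] <;> norm_num
  have hneg : ∀ {z : (Fin 4 → ℝ) → ℝ}, MemH (QT a b T) 2 z → ∀ i j,
      weakDeriv (QT a b T) j (fun p => -weakDeriv (QT a b T) i z p)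
        =ᵐ[volume.restrict (QT a b T)] fun p =>
          -weakDeriv (QT a b T) j (weakDeriv (QT a b T) i z) p := fun hz i j =>
    ((hz.weakDeriv i).hasWeakDeriv j).neg.weakDeriv_ae_eq hO
  have habs : ∀ {z : (Fin 4 → ℝ) → ℝ}, MemH (QT a b T) 2 z → ∀ j,
      weakDeriv (QT a b T) j (fun p => -weakDeriv (QT a b T) 2 z p + weakDeriv (QT a b T) 3 z p)
        =ᵐ[volume.restrict (QT a b T)] fun p =>
          -weakDeriv (QT a b T) j (weakDeriv (QT a b T) 2 z) p +
            weakDeriv (QT a b T) j (weakDeriv (QT a b T) 3 z) p := fun hz j =>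
    (((hz.weakDeriv 2).hasWeakDeriv j).neg.add
      ((hz.weakDeriv 3).hasWeakDeriv j)).weakDeriv_ae_eq hO
  have hcomm : ∀ {z : (Fin 4 → ℝ) → ℝ}, MemH (QT a b T) 2 z → ∀ i j,
      weakDeriv (QT a b T) j (weakDeriv (QT a b T) i z) =ᵐ[volume.restrict (QT a b T)]
        weakDeriv (QT a b T) i (weakDeriv (QT a b T) j z) := fun hz i j =>
    (hz.hasWeakDeriv i).comm hO (hz.hasWeakDeriv j) ((hz.weakDeriv i).hasWeakDeriv j)
      ((hz.weakDeriv j).hasWeakDeriv i)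
  have key := energy_estimate (lo := qLo b) (hi := qHi a T) hlt (w := fun x => u x - v x) (f := f)
    (W := fun i x => weakDeriv (QT a b T) i u x - weakDeriv (QT a b T) i v x)
    (H := fun i j x => weakDeriv (QT a b T) j (weakDeriv (QT a b T) i u) x -
      weakDeriv (QT a b T) j (weakDeriv (QT a b T) i v) x)
    (cu.initial.hasTrace.sub_of_eq cv.initial.hasTrace)
    (cu.initial_deriv.hasTrace.sub_of_eq cv.initial_deriv.hasTrace)
    (du.hasTrace.sub_of_eq dv.hasTrace)
    ((cu.absorbing.hasTrace.sub_of_eq cv.absorbing.hasTrace).congr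
      (ae_of_all _ fun x => by ring) fun j => by
        filter_upwards [habs hu j, habs hv j] with x h1 h2
        refine (congrArg₂ (· - ·) h1 h2).trans ?_
        ring)
    -- On the lower faces the outward derivative carries a minus sign, so subtracting in the order
    -- `v`, `u` gives the derivative of `u - v`.
    ((cv.neumann_x_lo.hasTrace.sub_of_eq cu.neumann_x_lo.hasTrace).congr
      (ae_of_all _ fun x => by ring) fun j => by
        filter_upwards [hneg hu 0 j, hneg hv 0 j] with x h1 h2
        refine (congrArg₂ (· - ·) h2 h1).trans ?_
        ring)
    (cu.neumann_x_hi.hasTrace.sub_of_eq cv.neumann_x_hi.hasTrace)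
    ((cv.neumann_y_lo.hasTrace.sub_of_eq cu.neumann_y_lo.hasTrace).congr
      (ae_of_all _ fun x => by ring) fun j => by
        filter_upwards [hneg hu 1 j, hneg hv 1 j] with x h1 h2
        refine (congrArg₂ (· - ·) h2 h1).trans ?_
        ring)
    (cu.neumann_y_hi.hasTrace.sub_of_eq cv.neumann_y_hi.hasTrace)
    (fun i j => by
      filter_upwards [hcomm hu i j, hcomm hv i j] with x h1 h2
      exact congrArg₂ (· - ·) h1 h2)
    hf hwave
  have eT : qHi a T 3 - qLo b 3 = T := by simp [qHi, qLo]
  rw [eT] at key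
  exact key

/-- Apply `(s + t)² ≤ 2 s² + 2 t²` to `u = (u - v) + v` and to each derivative. -/
theorem h1Norm_le_of_le {n : ℕ} {lo hi : Fin n → ℝ} {u v : (Fin n → ℝ) → ℝ} {A B : ℝ}
    (hu : MemH (box lo hi) 1 u) (hv : MemH (box lo hi) 1 v)
    (hA : ∑ i, ∫ x in box lo hi,
      (weakDeriv (box lo hi) i u x - weakDeriv (box lo hi) i v x) ^ 2 ≤ A)
    (hB : ∫ x in box lo hi, (u x - v x) ^ 2 ≤ B) :
    h1Norm (box lo hi) u ^ 2 ≤ 2 * (A + B) + 2 * h1Norm (box lo hi) v ^ 2 := by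
  have aux : ∀ {s t : (Fin n → ℝ) → ℝ}, MemLp s 2 (volume.restrict (box lo hi)) →
      MemLp t 2 (volume.restrict (box lo hi)) → l2NormSq (box lo hi) s ≤
        2 * (∫ x in box lo hi, (s x - t x) ^ 2) + 2 * l2NormSq (box lo hi) t := by
    intro s t hs ht
    have h := integral_add_sq_le (hs.sub ht) ht
    simpa [l2NormSq] using h
  have h1 := aux hu.memLp hv.memLp
  have h2 := Finset.sum_le_sum fun i (_ : i ∈ Finset.univ) =>
    aux (hu.weakDeriv i).memLp (hv.weakDeriv i).memLp
  rw [Finset.sum_add_distrib, ← Finset.mul_sum, ← Finset.mul_sum] at h2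
  rw [sq_h1Norm, sq_h1Norm]
  linarith

theorem sq_h2Norm {n : ℕ} (Ω : Set (Fin n → ℝ)) (u : (Fin n → ℝ) → ℝ) :
    h2Norm Ω u ^ 2 = l2NormSq Ω u + ∑ i, l2NormSq Ω (weakDeriv Ω i u) +
      ∑ i, ∑ j ∈ Finset.Ici i, l2NormSq Ω (weakDeriv Ω j (weakDeriv Ω i u)) := by
  refine Real.sq_sqrt (add_nonneg (add_nonneg (l2NormSq_nonneg _ _) ?_) ?_)
  · exact Finset.sum_nonneg fun _ _ => l2NormSq_nonneg _ _
  · exact Finset.sum_nonneg fun _ _ => Finset.sum_nonneg fun _ _ => l2NormSq_nonneg _ _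

theorem sq_h1Norm_le_sq_h2Norm {n : ℕ} (Ω : Set (Fin n → ℝ)) (u : (Fin n → ℝ) → ℝ) :
    h1Norm Ω u ^ 2 ≤ h2Norm Ω u ^ 2 := by
  rw [sq_h1Norm, sq_h2Norm]
  exact le_add_of_nonneg_right
    (Finset.sum_nonneg fun _ _ => Finset.sum_nonneg fun _ _ => l2NormSq_nonneg _ _)

theorem sum_l2NormSq_weakDeriv_weakDeriv_le {n : ℕ} (Ω : Set (Fin n → ℝ))
    (u : (Fin n → ℝ) → ℝ) :
    ∑ i, l2NormSq Ω (weakDeriv Ω i (weakDeriv Ω i u)) ≤ h2Norm Ω u ^ 2 := by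
  rw [sq_h2Norm]
  refine le_add_of_nonneg_of_le (add_nonneg (l2NormSq_nonneg _ _)
    (Finset.sum_nonneg fun _ _ => l2NormSq_nonneg _ _)) ?_
  refine Finset.sum_le_sum fun i _ => ?_
  exact Finset.single_le_sum (f := fun j => l2NormSq Ω (weakDeriv Ω j (weakDeriv Ω i u)))
    (fun _ _ => l2NormSq_nonneg _ _) (Finset.mem_Ici.2 le_rfl)

/-- The solution is controlled in `H¹` by any lifting of its Dirichlet data. -/
theorem sq_h1Norm_le_of_lifting {a b T : ℝ} (hba : b < a) (hT : 0 < T) {g : (Fin 3 → ℝ) → ℝ}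
    {u F : (Fin 4 → ℝ) → ℝ} (hu : IsSolution a b T g u) (hF : MemH (QT a b T) 2 F)
    (cF : HomogeneousConditions a b T F) (dF : DirichletData a b T g F) :
    h1Norm (QT a b T) u ^ 2 ≤
      (2 * (16 * T ^ 2 + 4 * T ^ 2 * (16 * T ^ 2)) + 2) * h2Norm (QT a b T) F ^ 2 := by
  have mF : ∀ i, MemLp (weakDeriv (QT a b T) i (weakDeriv (QT a b T) i F)) 2
      (volume.restrict (QT a b T)) := fun i => ((hF.weakDeriv i).weakDeriv i).memLp
  set G : Fin 4 → (Fin 4 → ℝ) → ℝ := fun i => weakDeriv (QT a b T) i (weakDeriv (QT a b T) i F)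
  have m0 : MemLp (fun x => G 0 x + G 1 x) 2 (volume.restrict (QT a b T)) := (mF 0).add (mF 1)
  have m1 : MemLp (fun x => G 2 x - G 3 x) 2 (volume.restrict (QT a b T)) := (mF 2).sub (mF 3)
  -- The source `ΔF - F_ττ` has four terms; two rounds of `(s ± t)² ≤ 2 s² + 2 t²` give the factor
  -- `4`.
  have bf : ∫ x in QT a b T, ((G 0 x + G 1 x) + (G 2 x - G 3 x)) ^ 2 ≤
      4 * h2Norm (QT a b T) F ^ 2 := by
    have h0 := integral_add_sq_le m0 m1
    have h1 := integral_add_sq_le (mF 0) (mF 1)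
    have h2 := integral_sub_sq_le (mF 2) (mF 3)
    have h3 := sum_l2NormSq_weakDeriv_weakDeriv_le (QT a b T) F
    rw [Fin.sum_univ_four] at h3
    simp only [l2NormSq] at h3
    linarith
  obtain ⟨e1, e2⟩ := stability_estimate hba hT (f := fun x => (G 0 x + G 1 x) + (G 2 x - G 3 x))
    hu.memH hF hu.homogeneous cF hu.dirichlet dF (m0.add m1) (by
      filter_upwards [hu.wave] with x hx
      rw [hx]
      ring)
  have hT2 : 0 ≤ 4 * T ^ 2 := by positivity
  have e1' := e1.trans (mul_le_mul_of_nonneg_left bf hT2)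
  -- The bound on `u - F` itself needs only the time derivative, a single term of the gradient sum.
  have e3 := (Finset.single_le_sum (f := fun i => ∫ x in QT a b T,
    (weakDeriv (QT a b T) i u x - weakDeriv (QT a b T) i F x) ^ 2)
    (fun _ _ => integral_nonneg fun _ => sq_nonneg _) (Finset.mem_univ 3)).trans e1'
  have e2' := e2.trans (mul_le_mul_of_nonneg_left e3 hT2)
  have h := h1Norm_le_of_le (lo := qLo b) (hi := qHi a T)
    ⟨hu.memH.1, fun i => (hu.memH.2 i).imp fun _ h => ⟨h.1, h.2.memLp⟩⟩
    ⟨hF.1, fun i => (hF.2 i).imp fun _ h => ⟨h.1, h.2.memLp⟩⟩ e1' e2'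
  have h4 := sq_h1Norm_le_sq_h2Norm (QT a b T) F
  change h1Norm (QT a b T) u ^ 2 ≤ _ + 2 * h1Norm (QT a b T) F ^ 2 at h
  linarith

theorem IsSolution.ae_unique {a b T : ℝ} (hba : b < a) (hT : 0 < T) {g : (Fin 3 → ℝ) → ℝ}
    {u v : (Fin 4 → ℝ) → ℝ} (hu : IsSolution a b T g u) (hv : IsSolution a b T g v) :
    u =ᵐ[volume.restrict (QT a b T)] v := by
  obtain ⟨e1, e2⟩ := stability_estimate hba hT (f := 0) hu.memH hv.memH hu.homogeneous
    hv.homogeneous hu.dirichlet hv.dirichlet MemLp.zero (by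
      filter_upwards [hu.wave, hv.wave] with x h1 h2
      rw [h1, h2, Pi.zero_apply]
      ring)
  have e3 := (Finset.single_le_sum (f := fun i => ∫ x in QT a b T,
    (weakDeriv (QT a b T) i u x - weakDeriv (QT a b T) i v x) ^ 2)
    (fun _ _ => integral_nonneg fun _ => sq_nonneg _) (Finset.mem_univ 3)).trans e1
  simp only [Pi.zero_apply, ne_eq, OfNat.ofNat_ne_zero, not_false_eq_true, zero_pow,
    integral_zero, mul_zero] at e3
  have e4 : ∫ x in QT a b T, (u x - v x) ^ 2 = 0 := by
    refine le_antisymm (e2.trans ?_) (integral_nonneg fun _ => sq_nonneg _)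
    exact mul_nonpos_of_nonneg_of_nonpos (by positivity) e3
  have h := (integral_eq_zero_iff_of_nonneg (fun _ => sq_nonneg _)
    (integrable_sq_of_memLp (hu.memH.memLp.sub hv.memH.memLp))).1 e4
  filter_upwards [h] with x hx
  exact sub_eq_zero.1 (pow_eq_zero_iff two_ne_zero |>.1 hx)

end TimeReversal

theorem theorem1 (a b T C : ℝ) (ha : 0 < a) (hb : b < 0) (hT : 0 < T) (hC : 0 < C) :
    ∃ C₁ : ℝ, 0 < C₁ ∧
      ∀ (g : (Fin 3 → ℝ) → ℝ) (u : (Fin 4 → ℝ) → ℝ),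
        TimeReversal.MemH (TimeReversal.GammaM T) 2 g →
        (∃ F : (Fin 4 → ℝ) → ℝ, TimeReversal.IsLifting a b T C g F) →
        TimeReversal.IsSolution a b T g u →
          (∀ v : (Fin 4 → ℝ) → ℝ, TimeReversal.IsSolution a b T g v →
            v =ᵐ[volume.restrict (TimeReversal.QT a b T)] u) ∧
          TimeReversal.h1Norm (TimeReversal.QT a b T) u ≤
            C₁ * TimeReversal.h2Norm (TimeReversal.GammaM T) g := by
  have hba : b < a := hb.trans ha
  set K : ℝ := 2 * (16 * T ^ 2 + 4 * T ^ 2 * (16 * T ^ 2)) + 2 with hK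
  have hKpos : 0 < K := by positivity
  -- `√K` bounds the solution by the lifting and depends only on `T`; `C` bounds the lifting by the
  -- data.
  refine ⟨√K * C, by positivity, fun g u _ ⟨F, hF⟩ hu =>
    ⟨fun v hv => hv.ae_unique hba hT hu, ?_⟩⟩
  have h := TimeReversal.sq_h1Norm_le_of_lifting hba hT hu hF.memH hF.homogeneous hF.dirichlet
  have hF0 : 0 ≤ TimeReversal.h2Norm (TimeReversal.QT a b T) F := Real.sqrt_nonneg _
  calc TimeReversal.h1Norm (TimeReversal.QT a b T) u
      ≤ √K * TimeReversal.h2Norm (TimeReversal.QT a b T) F := by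
        refine (sq_le_sq₀ (Real.sqrt_nonneg _) (by positivity)).1 ?_
        rw [mul_pow, Real.sq_sqrt hKpos.le]
        exact h
    _ ≤ √K * (C * TimeReversal.h2Norm (TimeReversal.GammaM T) g) :=
        mul_le_mul_of_nonneg_left hF.bound (Real.sqrt_nonneg _)
    _ = √K * C * TimeReversal.h2Norm (TimeReversal.GammaM T) g := by ring
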